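/- Let $X$ be a topological space, $A$ an abelian group and $k\ge 1$ an integer; $H^*(-;A)$ denotes singular cohomology. Let $PX=C([0,1],X)$ and $LX=C(S^1,X)$, where $S^1=\mathbb R/\mathbb Z$, be the path space and the free loop space with the compact-open topology, let $\pi:PX\to X\times X$, $\pi(\gamma)=(\gamma(0),\gamma(1))$, and let $r_1,r_2:LX\to PX$ be given by $(r_1\gamma)(t)=\gamma(t/2)$ and $(r_2\gamma)(t)=\gamma(1-t/2)$, so that $\pi\circ r_1=\pi\circ r_2$. Let $P_2X$ be the double mapping cylinder of $r_1$ and $r_2$, that is, the quotient space of $PX\sqcup (LX\times[0,1])\sqcup PX$ by $(\gamma,0)\sim r_1(\gamma)$ in the first copy and $(\gamma,1)\sim r_2(\gamma)$ in the second copy of $PX$, and let $i_1,i_2:PX\to P_2X$ be the inclusions of the two copies. Let $p_2:P_2X\to X\times X$ be the map that equals $\pi$ on both copies of $PX$ and sends the class of $(\gamma,s)$ to $\pi(r_1(\gamma))$. Let $\delta:H^{k-1}(LX;A)\to H^k(P_2X;A)$ be the connecting homomorphism of the Mayer–Vietoris sequence $$\cdots\to H^{k-1}(P_2X;A)\xrightarrow{(i_1^*,\,i_2^*)}H^{k-1}(PX;A)\oplus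 H^{k-1}(PX;A)\xrightarrow{r_1^*-r_2^*}H^{k-1}(LX;A)\xrightarrow{\ \delta\ }H^{k}(P_2X;A)\to\cdots$$ of this homotopy pushout. Let $\Delta:X\to X\times X$ be the diagonal map; a class $u\in H^k(X\times X;A)$ is called a zero-divisor if $\Delta^*u=0$ in $H^k(X;A)$. Then a class $u\in H^k(X\times X;A)$ is a zero-divisor if and only if $$p_2^*u\in\operatorname{im}\left[\delta:H^{k-1}(LX;A)\to H^k(P_2X;A)\right].$$ -/

import Mathlib

noncomputable section

namespace MVJoin

universe u v w

/-! ### Singular cohomology -/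

section Singular

variable {X : Type u} {Y : Type v} {A : Type w}
variable [TopologicalSpace X] [TopologicalSpace Y] [AddCommGroup A]

/-- Singular `n`-simplices of `X`. -/
abbrev SingSimplex (n : ℕ) (X : Type u) [TopologicalSpace X] : Type u :=
  C(stdSimplex ℝ (Fin (n + 1)), X)

/-- Singular `n`-cochains of `X` with coefficients in `A`, that is homomorphisms to `A` from the
free abelian group on the singular `n`-simplices. -/
abbrev SingCochain (n : ℕ) (X : Type u) [TopologicalSpace X] (A : Type w) : Type (max u w) :=
  SingSimplex n X → A

/-- The inclusion of the `i`-th face of the standard simplex. -/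
def faceMap (n : ℕ) (i : Fin (n + 2)) :
    C(stdSimplex ℝ (Fin (n + 1)), stdSimplex ℝ (Fin (n + 2))) :=
  ⟨stdSimplex.map i.succAbove, stdSimplex.continuous_map i.succAbove⟩

/-- The singular coboundary `(d c)(σ) = ∑ᵢ (-1)ⁱ c(σ ∘ δᵢ)`. -/
def coboundary (n : ℕ) (X : Type u) [TopologicalSpace X] (A : Type w) [AddCommGroup A] :
    SingCochain n X A →+ SingCochain (n + 1) X A where
  toFun c σ := ∑ i : Fin (n + 2), (-1 : ℤ) ^ (i : ℕ) • c (σ.comp (faceMap n i))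
  map_zero' := by ext σ; simp
  map_add' c c' := by ext σ; simp [Finset.sum_add_distrib]

theorem coboundary_apply (n : ℕ) (c : SingCochain n X A) (σ : SingSimplex (n + 1) X) :
    coboundary n X A c σ =
      ∑ i : Fin (n + 2), (-1 : ℤ) ^ (i : ℕ) • c (σ.comp (faceMap n i)) := rfl

/-- Singular cocycles. -/
def cocycles (n : ℕ) (X : Type u) [TopologicalSpace X] (A : Type w) [AddCommGroup A] :
    AddSubgroup (SingCochain n X A) :=
  (coboundary n X A).ker

/-- Singular coboundaries. -/
def coboundaries (n : ℕ) (X : Type u) [TopologicalSpace X] (A : Type w) [AddCommGroup A] :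
    AddSubgroup (SingCochain n X A) :=
  match n with
  | 0 => ⊥
  | m + 1 => (coboundary m X A).range

/-- Singular cohomology `Hⁿ(X; A)`. -/
abbrev SingCohomology (n : ℕ) (X : Type u) [TopologicalSpace X] (A : Type w) [AddCommGroup A] :
    Type (max u w) :=
  cocycles n X A ⧸ (coboundaries n X A).addSubgroupOf (cocycles n X A)

/-- The cohomology class of a cocycle. -/
def cohClass {n : ℕ} (c : cocycles n X A) : SingCohomology n X A :=
  QuotientAddGroup.mk c

/-- Pullback of cochains along a continuous map. -/
def cochainMap (n : ℕ) (A : Type w) [AddCommGroup A] (f : C(X, Y)) :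
    SingCochain n Y A →+ SingCochain n X A where
  toFun c σ := c (f.comp σ)
  map_zero' := rfl
  map_add' _ _ := rfl

theorem coboundary_cochainMap (n : ℕ) (f : C(X, Y)) (c : SingCochain n Y A) :
    coboundary n X A (cochainMap n A f c) = cochainMap (n + 1) A f (coboundary n Y A c) := rfl

theorem cochainMap_mem_cocycles {n : ℕ} (f : C(X, Y)) {c : SingCochain n Y A}
    (hc : c ∈ cocycles n Y A) : cochainMap n A f c ∈ cocycles n X A := by
  have h : coboundary n Y A c = 0 := hc
  change coboundary n X A (cochainMap n A f c) = 0
  rw [coboundary_cochainMap, h, map_zero]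

theorem cochainMap_mem_coboundaries {n : ℕ} (f : C(X, Y)) {c : SingCochain n Y A}
    (hc : c ∈ coboundaries n Y A) : cochainMap n A f c ∈ coboundaries n X A := by
  cases n with
  | zero =>
    have h : c = 0 := hc
    rw [h, map_zero]
    exact zero_mem _
  | succ m =>
    obtain ⟨b, rfl⟩ := hc
    exact ⟨cochainMap m A f b, coboundary_cochainMap m f b⟩

/-- Pullback of cocycles. -/
def cocycleMap (n : ℕ) (A : Type w) [AddCommGroup A] (f : C(X, Y)) :
    cocycles n Y A →+ cocycles n X A :=
  ((cochainMap n A f).comp (cocycles n Y A).subtype).codRestrict (cocycles n X A)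
    fun c => cochainMap_mem_cocycles f c.2

/-- The homomorphism `f^* : Hⁿ(Y; A) → Hⁿ(X; A)` induced by a continuous map `f : X → Y`. -/
def cohMap (n : ℕ) (A : Type w) [AddCommGroup A] (f : C(X, Y)) :
    SingCohomology n Y A →+ SingCohomology n X A :=
  QuotientAddGroup.map _ _ (cocycleMap n A f) fun _ hc => cochainMap_mem_coboundaries f hc

end Singular

/-! ### Subdivision of tuples of points

For a set `K` with a barycentre operation, `TupleChain m K` is the group of formal integer
combinations of `m`-tuples of points of `K`. -/

section Tuples

variable {K : Type u} {K' : Type v} {A : Type w} [AddCommGroup A]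

/-- Formal integer combinations of `m`-tuples of points of `K`. -/
abbrev TupleChain (m : ℕ) (K : Type u) : Type u := (Fin m → K) →₀ ℤ

/-- A tuple as a chain. -/
abbrev tup {m : ℕ} (v : Fin m → K) : TupleChain m K := Finsupp.single v 1

/-- Linear extension of a function on tuples. -/
abbrev lext {m : ℕ} {M : Type w} [AddCommGroup M] (f : (Fin m → K) → M) : TupleChain m K →ₗ[ℤ] M :=
  Finsupp.linearCombination ℤ f

theorem lext_tup {m : ℕ} {M : Type w} [AddCommGroup M] (f : (Fin m → K) → M) (v : Fin m → K) :
    lext f (tup v) = f v := by simp [lext, tup]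

theorem tupleHom_ext {m : ℕ} {M : Type w} [AddCommGroup M] {f g : TupleChain m K →ₗ[ℤ] M}
    (h : ∀ v, f (tup v) = g (tup v)) : f = g :=
  Finsupp.lhom_ext' fun v => LinearMap.ext_ring (h v)

/-- The alternating sum of the faces of a tuple. -/
def bdry (m : ℕ) (K : Type u) : TupleChain (m + 1) K →ₗ[ℤ] TupleChain m K :=
  lext fun v => ∑ i : Fin (m + 1), (-1 : ℤ) ^ (i : ℕ) • tup (v ∘ i.succAbove)

/-- The cone operator, adding a first point. -/
def cone (m : ℕ) (b : K) : TupleChain m K →ₗ[ℤ] TupleChain (m + 1) K :=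
  lext fun v => tup (Fin.cons b v : Fin (m + 1) → K)

theorem bdry_tup {m : ℕ} (v : Fin (m + 1) → K) :
    bdry m K (tup v) = ∑ i : Fin (m + 1), (-1 : ℤ) ^ (i : ℕ) • tup (v ∘ i.succAbove) :=
  lext_tup _ _

theorem cone_tup {m : ℕ} (b : K) (v : Fin m → K) :
    cone m b (tup v) = tup (Fin.cons b v : Fin (m + 1) → K) :=
  lext_tup _ _

theorem bdry_cone_zero (b : K) (x : TupleChain 0 K) : bdry 0 K (cone 0 b x) = x := by
  have : (bdry 0 K).comp (cone 0 b) = LinearMap.id := by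
    refine tupleHom_ext fun v => ?_
    simp only [LinearMap.comp_apply, cone_tup, bdry_tup, LinearMap.id_apply]
    simp
  exact LinearMap.congr_fun this x

theorem bdry_cone {m : ℕ} (b : K) (x : TupleChain (m + 1) K) :
    bdry (m + 1) K (cone (m + 1) b x) = x - cone m b (bdry m K x) := by
  have : (bdry (m + 1) K).comp (cone (m + 1) b) =
      LinearMap.id - (cone m b).comp (bdry m K) := by
    refine tupleHom_ext fun v => ?_
    simp only [LinearMap.comp_apply, LinearMap.sub_apply, cone_tup, bdry_tup, LinearMap.id_apply]
    rw [Fin.sum_univ_succ]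
    have h0 : (Fin.cons b v : Fin (m + 2) → K) ∘ (0 : Fin (m + 2)).succAbove = v := by
      ext i; simp
    have hs : ∀ j : Fin (m + 1), (Fin.cons b v : Fin (m + 2) → K) ∘ (j.succ).succAbove =
        Fin.cons b (v ∘ j.succAbove) := by
      intro j
      ext i
      refine Fin.cases ?_ (fun i => ?_) i <;> simp
    simp only [h0, hs, map_sum, map_zsmul, cone_tup]
    simp [pow_succ, sub_eq_add_neg]
  exact LinearMap.congr_fun this x

theorem tup_eq_cone {m : ℕ} (v : Fin (m + 1) → K) : tup v = cone m (v 0) (tup (Fin.tail v)) := by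
  rw [cone_tup, Fin.cons_self_tail]

theorem bdry_bdry {m : ℕ} (x : TupleChain (m + 2) K) : bdry m K (bdry (m + 1) K x) = 0 := by
  have : (bdry m K).comp (bdry (m + 1) K) = 0 := by
    clear x
    induction m with
    | zero =>
      refine tupleHom_ext fun v => ?_
      rw [tup_eq_cone, LinearMap.comp_apply, bdry_cone, map_sub, bdry_cone_zero, sub_self]
      rfl
    | succ m ih =>
      refine tupleHom_ext fun v => ?_
      have h := LinearMap.congr_fun ih (tup (Fin.tail v))
      rw [LinearMap.comp_apply] at h
      rw [tup_eq_cone, LinearMap.comp_apply, bdry_cone, map_sub, bdry_cone, h]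
      simp
  exact LinearMap.congr_fun this x

variable (bar : ∀ m : ℕ, (Fin (m + 1) → K) → K)

/-- Barycentric subdivision. -/
def sd : ∀ m : ℕ, TupleChain m K →ₗ[ℤ] TupleChain m K
  | 0 => LinearMap.id
  | m + 1 => lext fun v => cone m (bar m v) (sd m (bdry m K (tup v)))

/-- The chain homotopy between the identity and barycentric subdivision. -/
def sdHtpy : ∀ m : ℕ, TupleChain m K →ₗ[ℤ] TupleChain (m + 1) K
  | 0 => 0
  | m + 1 => lext fun v =>
      cone (m + 1) (bar m v) (tup v - sdHtpy m (bdry m K (tup v)))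

theorem sd_tup {m : ℕ} (v : Fin (m + 1) → K) :
    sd bar (m + 1) (tup v) = cone m (bar m v) (sd bar m (bdry m K (tup v))) :=
  lext_tup _ _

theorem sdHtpy_tup {m : ℕ} (v : Fin (m + 1) → K) :
    sdHtpy bar (m + 1) (tup v) =
      cone (m + 1) (bar m v) (tup v - sdHtpy bar m (bdry m K (tup v))) :=
  lext_tup _ _

theorem bdry_sd {m : ℕ} (x : TupleChain (m + 1) K) :
    bdry m K (sd bar (m + 1) x) = sd bar m (bdry m K x) := by
  have : (bdry m K).comp (sd bar (m + 1)) = (sd bar m).comp (bdry m K) := by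
    clear x
    induction m with
    | zero =>
      refine tupleHom_ext fun v => ?_
      rw [LinearMap.comp_apply, LinearMap.comp_apply, sd_tup, bdry_cone_zero]
    | succ m ih =>
      refine tupleHom_ext fun v => ?_
      have h := LinearMap.congr_fun ih (bdry (m + 1) K (tup v))
      rw [LinearMap.comp_apply, LinearMap.comp_apply, bdry_bdry, map_zero] at h
      rw [LinearMap.comp_apply, LinearMap.comp_apply, sd_tup, bdry_cone, h, map_zero, sub_zero]
  exact LinearMap.congr_fun this x

theorem bdry_sdHtpy {m : ℕ} (x : TupleChain (m + 1) K) :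
    bdry (m + 1) K (sdHtpy bar (m + 1) x) =
      x - sd bar (m + 1) x - sdHtpy bar m (bdry m K x) := by
  have : (bdry (m + 1) K).comp (sdHtpy bar (m + 1)) =
      LinearMap.id - sd bar (m + 1) - (sdHtpy bar m).comp (bdry m K) := by
    clear x
    induction m with
    | zero =>
      refine tupleHom_ext fun v => ?_
      simp only [LinearMap.comp_apply, LinearMap.sub_apply, LinearMap.id_apply]
      rw [sdHtpy_tup, bdry_cone, sd_tup]
      simp [sdHtpy, sd]
    | succ m ih =>
      refine tupleHom_ext fun v => ?_
      have h := LinearMap.congr_fun ih (bdry (m + 1) K (tup v))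
      simp only [LinearMap.comp_apply, LinearMap.sub_apply, LinearMap.id_apply, bdry_bdry,
        map_zero, sub_zero] at h
      simp only [LinearMap.comp_apply, LinearMap.sub_apply, LinearMap.id_apply]
      rw [sdHtpy_tup, bdry_cone, sd_tup, map_sub, h]
      simp only [map_sub]
      abel
  exact LinearMap.congr_fun this x

/-- Iterated subdivision. -/
def sdIter (m N : ℕ) : TupleChain m K →ₗ[ℤ] TupleChain m K := (sd bar m) ^ N

theorem sdIter_succ {m : ℕ} (N : ℕ) (x : TupleChain m K) :
    sdIter bar m (N + 1) x = sd bar m (sdIter bar m N x) := by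
  simp [sdIter, pow_succ']

theorem bdry_sdIter {m : ℕ} (N : ℕ) (x : TupleChain (m + 1) K) :
    bdry m K (sdIter bar (m + 1) N x) = sdIter bar m N (bdry m K x) := by
  induction N with
  | zero => rfl
  | succ N ih => rw [sdIter_succ, sdIter_succ, bdry_sd, ih]

/-- The chain homotopy between the identity and the `N`-fold subdivision. -/
def sdSum (m N : ℕ) : TupleChain m K →ₗ[ℤ] TupleChain (m + 1) K :=
  ∑ i ∈ Finset.range N, (sdHtpy bar m).comp (sdIter bar m i)

theorem sdSum_succ {m : ℕ} (N : ℕ) (x : TupleChain m K) :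
    sdSum bar m (N + 1) x = sdSum bar m N x + sdHtpy bar m (sdIter bar m N x) := by
  simp [sdSum, Finset.sum_range_succ]

theorem bdry_sdSum {m : ℕ} (N : ℕ) (x : TupleChain (m + 1) K) :
    bdry (m + 1) K (sdSum bar (m + 1) N x) =
      x - sdIter bar (m + 1) N x - sdSum bar m N (bdry m K x) := by
  induction N with
  | zero => simp [sdSum, sdIter]
  | succ N ih =>
    rw [sdSum_succ, map_add, ih, bdry_sdHtpy, bdry_sdIter, sdSum_succ, sdIter_succ]
    abel

/-! Naturality. -/

/-- The map on chains induced by a map of sets. -/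
def tupMap (m : ℕ) (f : K → K') : TupleChain m K →ₗ[ℤ] TupleChain m K' :=
  lext fun v => tup (f ∘ v)

theorem tupMap_tup {m : ℕ} (f : K → K') (v : Fin m → K) : tupMap m f (tup v) = tup (f ∘ v) :=
  lext_tup _ _

theorem tupMap_bdry {m : ℕ} (f : K → K') (x : TupleChain (m + 1) K) :
    tupMap m f (bdry m K x) = bdry m K' (tupMap (m + 1) f x) := by
  have : (tupMap m f).comp (bdry m K) = (bdry m K').comp (tupMap (m + 1) f) := by
    refine tupleHom_ext fun v => ?_
    simp only [LinearMap.comp_apply, tupMap_tup, bdry_tup, map_sum, map_zsmul]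
    rfl
  exact LinearMap.congr_fun this x

theorem tupMap_cone {m : ℕ} (f : K → K') (b : K) (x : TupleChain m K) :
    tupMap (m + 1) f (cone m b x) = cone m (f b) (tupMap m f x) := by
  have : (tupMap (m + 1) f).comp (cone m b) = (cone m (f b)).comp (tupMap m f) := by
    refine tupleHom_ext fun v => ?_
    simp only [LinearMap.comp_apply, tupMap_tup, cone_tup]
    congr 1
    ext i
    refine Fin.cases ?_ (fun i => ?_) i <;> simp
  exact LinearMap.congr_fun this x

variable {bar} {bar' : ∀ m : ℕ, (Fin (m + 1) → K') → K'} {f : K → K'}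

theorem tupMap_sd (hf : ∀ m v, f (bar m v) = bar' m (f ∘ v)) {m : ℕ} (x : TupleChain m K) :
    tupMap m f (sd bar m x) = sd bar' m (tupMap m f x) := by
  have : (tupMap m f).comp (sd bar m) = (sd bar' m).comp (tupMap m f) := by
    clear x
    induction m with
    | zero => rfl
    | succ m ih =>
      refine tupleHom_ext fun v => ?_
      have h := LinearMap.congr_fun ih (bdry m K (tup v))
      simp only [LinearMap.comp_apply] at h ⊢
      rw [tupMap_tup, sd_tup, sd_tup, tupMap_cone, h, hf, tupMap_bdry, tupMap_tup]
  exact LinearMap.congr_fun this x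

theorem tupMap_sdHtpy (hf : ∀ m v, f (bar m v) = bar' m (f ∘ v)) {m : ℕ} (x : TupleChain m K) :
    tupMap (m + 1) f (sdHtpy bar m x) = sdHtpy bar' m (tupMap m f x) := by
  have : (tupMap (m + 1) f).comp (sdHtpy bar m) = (sdHtpy bar' m).comp (tupMap m f) := by
    clear x
    induction m with
    | zero => ext; simp [sdHtpy]
    | succ m ih =>
      refine tupleHom_ext fun v => ?_
      have h := LinearMap.congr_fun ih (bdry m K (tup v))
      simp only [LinearMap.comp_apply] at h ⊢
      rw [tupMap_tup, sdHtpy_tup, sdHtpy_tup, tupMap_cone, map_sub, h, hf, tupMap_bdry,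
        tupMap_tup]
  exact LinearMap.congr_fun this x

theorem tupMap_sdIter (hf : ∀ m v, f (bar m v) = bar' m (f ∘ v)) {m : ℕ} (N : ℕ)
    (x : TupleChain m K) :
    tupMap m f (sdIter bar m N x) = sdIter bar' m N (tupMap m f x) := by
  induction N with
  | zero => rfl
  | succ N ih => rw [sdIter_succ, sdIter_succ, tupMap_sd hf, ih]

theorem tupMap_sdSum (hf : ∀ m v, f (bar m v) = bar' m (f ∘ v)) {m : ℕ} (N : ℕ)
    (x : TupleChain m K) :
    tupMap (m + 1) f (sdSum bar m N x) = sdSum bar' m N (tupMap m f x) := by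
  simp [sdSum, map_sum, tupMap_sdHtpy hf, tupMap_sdIter hf]

/-! Supports. -/

/-- Chains supported on tuples with a given property. -/
abbrev supp {m : ℕ} (s : Set (Fin m → K)) : Submodule ℤ (TupleChain m K) :=
  Finsupp.supported ℤ ℤ s

theorem tup_mem_supp {m : ℕ} {s : Set (Fin m → K)} {v : Fin m → K} (h : v ∈ s) :
    tup v ∈ supp s := Finsupp.single_mem_supported ℤ 1 h

theorem map_mem_of_supp {m : ℕ} {M : Type w} [AddCommGroup M] (g : TupleChain m K →ₗ[ℤ] M)
    {s : Set (Fin m → K)} {N : Submodule ℤ M} (h : ∀ v ∈ s, g (tup v) ∈ N)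
    {x : TupleChain m K} (hx : x ∈ supp s) : g x ∈ N := by
  have : supp s ≤ N.comap g := by
    rw [supp, Finsupp.supported_eq_span_single, Submodule.span_le]
    rintro _ ⟨v, hv, rfl⟩
    exact h v hv
  exact this hx

/-- Tuples of points of `C`. -/
def tuplesIn (m : ℕ) (C : Set K) : Set (Fin m → K) := {v | ∀ i, v i ∈ C}

theorem bdry_mem_supp {m : ℕ} {C : Set K} {v : Fin (m + 1) → K} (hv : v ∈ tuplesIn (m + 1) C) :
    bdry m K (tup v) ∈ supp (tuplesIn m C) := by
  rw [bdry_tup]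
  exact Submodule.sum_mem _ fun i _ => Submodule.smul_mem _ _ (tup_mem_supp fun j => hv _)

theorem cone_mem_supp {m : ℕ} {C : Set K} {b : K} (hb : b ∈ C) {x : TupleChain m K}
    (hx : x ∈ supp (tuplesIn m C)) : cone m b x ∈ supp (tuplesIn (m + 1) C) := by
  refine map_mem_of_supp (cone m b) (fun v hv => ?_) hx
  rw [cone_tup]
  refine tup_mem_supp fun i => ?_
  refine Fin.cases ?_ (fun i => ?_) i
  · simpa using hb
  · simpa using hv i

theorem sd_mem_supp {C : Set K} (hC : ∀ m v, v ∈ tuplesIn (m + 1) C → bar m v ∈ C) {m : ℕ}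
    {x : TupleChain m K} (hx : x ∈ supp (tuplesIn m C)) : sd bar m x ∈ supp (tuplesIn m C) := by
  induction m with
  | zero => exact hx
  | succ m ih =>
    refine map_mem_of_supp (sd bar (m + 1)) (fun v hv => ?_) hx
    rw [sd_tup]
    exact cone_mem_supp (hC m v hv) (ih (bdry_mem_supp hv))

theorem sdHtpy_mem_supp {C : Set K} (hC : ∀ m v, v ∈ tuplesIn (m + 1) C → bar m v ∈ C) {m : ℕ}
    {x : TupleChain m K} (hx : x ∈ supp (tuplesIn m C)) :
    sdHtpy bar m x ∈ supp (tuplesIn (m + 1) C) := by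
  induction m with
  | zero => exact Submodule.zero_mem _
  | succ m ih =>
    refine map_mem_of_supp (sdHtpy bar (m + 1)) (fun v hv => ?_) hx
    rw [sdHtpy_tup]
    exact cone_mem_supp (hC m v hv) (Submodule.sub_mem _ (tup_mem_supp hv) (ih (bdry_mem_supp hv)))

end Tuples

/-! ### Small simplices -/

section Small

/-- The affine simplex spanned by a tuple of points of a standard simplex. -/
def affSimplex {N m : ℕ} (v : Fin (m + 1) → stdSimplex ℝ (Fin (N + 1))) :
    C(stdSimplex ℝ (Fin (m + 1)), stdSimplex ℝ (Fin (N + 1))) where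
  toFun x := ⟨∑ i, (x : Fin (m + 1) → ℝ) i • (v i : Fin (N + 1) → ℝ),
    (convex_stdSimplex ℝ _).sum_mem (fun i _ => x.2.1 i) x.2.2 fun i _ => (v i).2⟩
  continuous_toFun := by
    refine Continuous.subtype_mk (continuous_finsetSum _ fun i _ => ?_) _
    exact ((continuous_apply i).comp continuous_subtype_val).smul continuous_const

theorem affSimplex_mem {N m : ℕ} {v : Fin (m + 1) → stdSimplex ℝ (Fin (N + 1))}
    {C : Set (Fin (N + 1) → ℝ)} (hC : Convex ℝ C) (hv : ∀ i, (v i : Fin (N + 1) → ℝ) ∈ C)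
    (x : stdSimplex ℝ (Fin (m + 1))) : (affSimplex v x : Fin (N + 1) → ℝ) ∈ C :=
  hC.sum_mem (fun i _ => x.2.1 i) x.2.2 fun i _ => hv i

/-- The barycentre of a tuple of points of a standard simplex. -/
def bary {N : ℕ} (m : ℕ) (v : Fin (m + 1) → stdSimplex ℝ (Fin (N + 1))) :
    stdSimplex ℝ (Fin (N + 1)) :=
  affSimplex v stdSimplex.barycenter

/-- The tuple of vertices of the standard simplex. -/
def vert (n : ℕ) : Fin (n + 1) → stdSimplex ℝ (Fin (n + 1)) := fun i => stdSimplex.vertex i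

theorem affSimplex_coe {N m : ℕ} (v : Fin (m + 1) → stdSimplex ℝ (Fin (N + 1)))
    (x : stdSimplex ℝ (Fin (m + 1))) : (affSimplex v x).1 = ∑ i, x.1 i • (v i).1 := rfl

theorem faceMap_coe {n : ℕ} (j : Fin (n + 2)) (x : stdSimplex ℝ (Fin (n + 1))) :
    (faceMap n j x).1 = FunOnFinite.linearMap ℝ ℝ j.succAbove x.1 := rfl

theorem faceMap_apply_succAbove {n : ℕ} (j : Fin (n + 2)) (x : stdSimplex ℝ (Fin (n + 1)))
    (i : Fin (n + 1)) : (faceMap n j x).1 (j.succAbove i) = x.1 i := by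
  rw [faceMap_coe, FunOnFinite.linearMap_apply_apply]
  simp [Finset.filter_eq']

theorem faceMap_apply_self {n : ℕ} (j : Fin (n + 2)) (x : stdSimplex ℝ (Fin (n + 1))) :
    (faceMap n j x).1 j = 0 := by
  rw [faceMap_coe, FunOnFinite.linearMap_apply_apply]
  simp [Fin.succAbove_ne]

theorem affSimplex_vert (n : ℕ) : affSimplex (vert n) = ContinuousMap.id _ := by
  ext1 x
  refine Subtype.ext ?_
  rw [affSimplex_coe]
  funext j
  simp [vert, Pi.single_apply, Finset.sum_apply]

theorem faceMap_affSimplex {n m : ℕ} (j : Fin (n + 2))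
    (v : Fin (m + 1) → stdSimplex ℝ (Fin (n + 1))) :
    (faceMap n j).comp (affSimplex v) = affSimplex (faceMap n j ∘ v) := by
  ext1 x
  refine Subtype.ext ?_
  rw [ContinuousMap.comp_apply, faceMap_coe, affSimplex_coe, affSimplex_coe, map_sum]
  refine Finset.sum_congr rfl fun i _ => ?_
  rw [map_smul]
  rfl

theorem faceMap_bary {n m : ℕ} (j : Fin (n + 2))
    (v : Fin (m + 1) → stdSimplex ℝ (Fin (n + 1))) :
    faceMap n j (bary m v) = bary m (faceMap n j ∘ v) :=
  DFunLike.congr_fun (faceMap_affSimplex j v) _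

theorem faceMap_vert (n : ℕ) (j : Fin (n + 2)) :
    faceMap n j ∘ vert n = vert (n + 1) ∘ j.succAbove := by
  funext i
  exact stdSimplex.map_vertex _ _

theorem affSimplex_vert_face (n : ℕ) (j : Fin (n + 2)) :
    affSimplex (vert (n + 1) ∘ j.succAbove) = faceMap n j := by
  rw [← faceMap_vert, ← faceMap_affSimplex, affSimplex_vert, ContinuousMap.comp_id]

theorem affSimplex_comp_face {N m : ℕ} (v : Fin (m + 2) → stdSimplex ℝ (Fin (N + 1)))
    (j : Fin (m + 2)) : (affSimplex v).comp (faceMap m j) = affSimplex (v ∘ j.succAbove) := by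
  ext1 x
  refine Subtype.ext ?_
  rw [ContinuousMap.comp_apply, affSimplex_coe, affSimplex_coe, Fin.sum_univ_succAbove _ j,
    faceMap_apply_self, zero_smul, zero_add]
  refine Finset.sum_congr rfl fun i _ => ?_
  rw [faceMap_apply_succAbove]
  rfl

theorem dist_bary_le {N m : ℕ} {v : Fin (m + 1) → stdSimplex ℝ (Fin (N + 1))} {D : ℝ}
    (hv : ∀ i j, dist (v i) (v j) ≤ D) (j : Fin (m + 1)) :
    dist (bary m v) (v j) ≤ (1 - 1 / ((m : ℝ) + 1)) * D := by
  have hm : (0 : ℝ) < (m : ℝ) + 1 := by positivity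
  have h1 : (bary m v).1 - (v j).1 = ∑ i, ((m : ℝ) + 1)⁻¹ • ((v i).1 - (v j).1) := by
    rw [← Finset.smul_sum, Finset.sum_sub_distrib, Finset.sum_const, Finset.card_univ,
      Fintype.card_fin, smul_sub, ← Nat.cast_smul_eq_nsmul ℝ, smul_smul, Nat.cast_add,
      Nat.cast_one, inv_mul_cancel₀ hm.ne', one_smul, Finset.smul_sum]
    congr 1
    rw [bary, affSimplex_coe]
    refine Finset.sum_congr rfl fun i _ => ?_
    rw [stdSimplex.barycenter_apply, Fintype.card_fin, Nat.cast_add, Nat.cast_one]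
  have h2 : dist (bary m v) (v j) = ‖(bary m v).1 - (v j).1‖ :=
    dist_eq_norm (bary m v).1 (v j).1
  have h3 : ∀ i, ‖((m : ℝ) + 1)⁻¹ • ((v i).1 - (v j).1)‖ ≤
      if i = j then 0 else ((m : ℝ) + 1)⁻¹ * D := by
    intro i
    split_ifs with h
    · rw [h, sub_self, smul_zero, norm_zero]
    · rw [norm_smul, Real.norm_of_nonneg (inv_nonneg.2 hm.le), ← dist_eq_norm]
      exact mul_le_mul_of_nonneg_left (hv i j) (inv_nonneg.2 hm.le)
  rw [h2, h1]
  refine (norm_sum_le_of_le _ fun i _ => h3 i).trans (le_of_eq ?_)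
  rw [Finset.sum_ite]
  simp only [Finset.sum_const_zero, zero_add, Finset.sum_const, nsmul_eq_mul]
  rw [Finset.filter_ne', Finset.card_erase_of_mem (Finset.mem_univ _), Finset.card_univ,
    Fintype.card_fin, Nat.add_sub_cancel]
  field_simp
  ring

/-- Tuples whose entries have pairwise distance at most `D`. -/
def meshSet (N m : ℕ) (D : ℝ) : Set (Fin m → stdSimplex ℝ (Fin (N + 1))) :=
  {v | ∀ i j, dist (v i) (v j) ≤ D}

theorem sd_mesh {N M : ℕ} {D : ℝ} (hD : 0 ≤ D) {m : ℕ} (hm : m ≤ M)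
    {x : TupleChain m (stdSimplex ℝ (Fin (N + 1)))} (hx : x ∈ supp (meshSet N m D)) :
    sd bary m x ∈ supp (meshSet N m ((1 - 1 / (M : ℝ)) * D)) := by
  induction m with
  | zero => exact Finsupp.supported_mono (fun v _ i => i.elim0) hx
  | succ m ih =>
    refine map_mem_of_supp (sd bary (m + 1)) (fun v hv => ?_) hx
    rw [sd_tup]
    have hr : (1 - 1 / ((m : ℝ) + 1)) * D ≤ (1 - 1 / (M : ℝ)) * D := by
      have : ((m : ℝ) + 1) ≤ M := by exact_mod_cast hm
      gcongr
    set r := (1 - 1 / (M : ℝ)) * D with hrdef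
    set b := bary m v with hb
    have h1 : sd bary m (bdry m _ (tup v)) ∈ supp (meshSet N m r) := by
      refine ih (by omega) ?_
      rw [bdry_tup]
      exact Submodule.sum_mem _ fun i _ => Submodule.smul_mem _ _
        (tup_mem_supp fun j k => hv _ _)
    have h2 : sd bary m (bdry m _ (tup v)) ∈
        supp (tuplesIn m {p : stdSimplex ℝ (Fin (N + 1)) |
          (p : Fin (N + 1) → ℝ) ∈ Metric.closedBall (b : Fin (N + 1) → ℝ) r}) := by
      refine sd_mem_supp (fun k w hw => ?_) (bdry_mem_supp fun i => ?_)
      · exact affSimplex_mem (convex_closedBall _ _) hw _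
      · have := (dist_bary_le hv i).trans hr
        rw [dist_comm] at this
        exact this
    have h3 := Submodule.mem_inf.2 ⟨h1, h2⟩
    rw [supp, supp, ← Finsupp.supported_inter] at h3
    refine map_mem_of_supp (cone m b) (fun w hw => ?_) h3
    rw [cone_tup]
    refine tup_mem_supp fun i j => ?_
    have hr0 : 0 ≤ r := by
      refine mul_nonneg ?_ hD
      have : (1 : ℝ) ≤ M := by exact_mod_cast (by omega : 1 ≤ M)
      rw [sub_nonneg, div_le_one (by linarith)]
      exact this
    refine Fin.cases ?_ (fun i => ?_) i <;> refine Fin.cases ?_ (fun j => ?_) j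
    · simpa using hr0
    · have := hw.2 j
      rw [Set.mem_ofPred_eq, Metric.mem_closedBall, dist_comm] at this
      exact this
    · exact hw.2 i
    · simpa using hw.1 i j

theorem sdIter_mesh {N m : ℕ} {D : ℝ} (hD : 0 ≤ D) (k : ℕ)
    {x : TupleChain (m + 1) (stdSimplex ℝ (Fin (N + 1)))} (hx : x ∈ supp (meshSet N (m + 1) D)) :
    sdIter bary (m + 1) k x ∈
      supp (meshSet N (m + 1) ((1 - 1 / ((m + 1 : ℕ) : ℝ)) ^ k * D)) := by
  have hr0 : 0 ≤ 1 - 1 / ((m + 1 : ℕ) : ℝ) := by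
    have : (1 : ℝ) ≤ (m + 1 : ℕ) := by exact_mod_cast (by omega : 1 ≤ m + 1)
    rw [sub_nonneg, div_le_one (by linarith)]
    exact this
  induction k with
  | zero => simpa [sdIter] using hx
  | succ k ih =>
    rw [sdIter_succ, pow_succ', mul_assoc]
    exact sd_mesh (mul_nonneg (pow_nonneg hr0 k) hD) le_rfl ih

variable {Y : Type u} [TopologicalSpace Y] {A : Type w} [AddCommGroup A]

/-- A singular simplex is small if its image lies in `U` or in `V`. -/
def IsSmall (U V : Set Y) {n : ℕ} (σ : SingSimplex n Y) : Prop :=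
  (∀ x, σ x ∈ U) ∨ ∀ x, σ x ∈ V

/-- Tuples contained in a convex set which `σ` maps into `U` or into `V`. -/
def goodSet (U V : Set Y) {n : ℕ} (σ : SingSimplex n Y) (m : ℕ) :
    Set (Fin m → stdSimplex ℝ (Fin (n + 1))) :=
  {v | ∃ C : Set (Fin (n + 1) → ℝ), Convex ℝ C ∧ (∀ i, (v i : Fin (n + 1) → ℝ) ∈ C) ∧
    ((∀ p : stdSimplex ℝ (Fin (n + 1)), (p : Fin (n + 1) → ℝ) ∈ C → σ p ∈ U) ∨
      ∀ p : stdSimplex ℝ (Fin (n + 1)), (p : Fin (n + 1) → ℝ) ∈ C → σ p ∈ V)}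

variable {U V : Set Y}

theorem sd_good {n m : ℕ} {σ : SingSimplex n Y}
    {x : TupleChain m (stdSimplex ℝ (Fin (n + 1)))} (hx : x ∈ supp (goodSet U V σ m)) :
    sd bary m x ∈ supp (goodSet U V σ m) := by
  refine map_mem_of_supp _ (fun v hv => ?_) hx
  obtain ⟨C, hC, hvC, hσ⟩ := hv
  have hsub : tuplesIn m {p : stdSimplex ℝ (Fin (n + 1)) | (p : Fin (n + 1) → ℝ) ∈ C} ⊆
      goodSet U V σ m := by
    intro w hw
    exact ⟨C, hC, hw, hσ⟩
  refine Finsupp.supported_mono hsub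
    (sd_mem_supp (C := {p : stdSimplex ℝ (Fin (n + 1)) | (p : Fin (n + 1) → ℝ) ∈ C})
      (fun k w hw => affSimplex_mem hC hw _) (tup_mem_supp hvC))

theorem sdHtpy_good {n m : ℕ} {σ : SingSimplex n Y}
    {x : TupleChain m (stdSimplex ℝ (Fin (n + 1)))} (hx : x ∈ supp (goodSet U V σ m)) :
    sdHtpy bary m x ∈ supp (goodSet U V σ (m + 1)) := by
  refine map_mem_of_supp _ (fun v hv => ?_) hx
  obtain ⟨C, hC, hvC, hσ⟩ := hv
  have hsub : tuplesIn (m + 1) {p : stdSimplex ℝ (Fin (n + 1)) | (p : Fin (n + 1) → ℝ) ∈ C} ⊆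
      goodSet U V σ (m + 1) := by
    intro w hw
    exact ⟨C, hC, hw, hσ⟩
  refine Finsupp.supported_mono hsub
    (sdHtpy_mem_supp (C := {p : stdSimplex ℝ (Fin (n + 1)) | (p : Fin (n + 1) → ℝ) ∈ C})
      (fun k w hw => affSimplex_mem hC hw _) (tup_mem_supp hvC))

/-- The `k`-fold subdivision of `σ` is small. -/
def IsFine (U V : Set Y) {n : ℕ} (σ : SingSimplex n Y) (k : ℕ) : Prop :=
  sdIter bary (n + 1) k (tup (vert n)) ∈ supp (goodSet U V σ (n + 1))

theorem IsFine.mono {n : ℕ} {σ : SingSimplex n Y} {k l : ℕ} (h : IsFine U V σ k) (hkl : k ≤ l) :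
    IsFine U V σ l := by
  induction l, hkl using Nat.le_induction with
  | base => exact h
  | succ l _ ih =>
    unfold IsFine
    rw [sdIter_succ]
    exact sd_good ih

theorem exists_isFine (hU : IsOpen U) (hV : IsOpen V) (hUV : U ∪ V = Set.univ) {n : ℕ}
    (σ : SingSimplex n Y) : ∃ k, IsFine U V σ k := by
  obtain ⟨δ, hδ, hball⟩ := lebesgue_number_lemma_of_metric
    (s := (Set.univ : Set (stdSimplex ℝ (Fin (n + 1))))) (c := fun i : Bool => σ ⁻¹' (cond i U V))
    isCompact_univ
    (fun i => by cases i; exacts [hV.preimage σ.continuous, hU.preimage σ.continuous])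
    (fun x _ => by
      have : σ x ∈ U ∪ V := hUV ▸ Set.mem_univ _
      rcases this with h | h
      · exact Set.mem_iUnion.2 ⟨true, h⟩
      · exact Set.mem_iUnion.2 ⟨false, h⟩)
  have hr0 : 0 ≤ 1 - 1 / ((n + 1 : ℕ) : ℝ) := by
    have : (1 : ℝ) ≤ (n + 1 : ℕ) := by exact_mod_cast (by omega : 1 ≤ n + 1)
    rw [sub_nonneg, div_le_one (by linarith)]
    exact this
  have hr1 : 1 - 1 / ((n + 1 : ℕ) : ℝ) < 1 := by
    have : (0 : ℝ) < 1 / ((n + 1 : ℕ) : ℝ) := by positivity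
    linarith
  obtain ⟨k, hk⟩ := exists_pow_lt_of_lt_one hδ hr1
  refine ⟨k, ?_⟩
  have hmesh : tup (vert n) ∈ supp (meshSet n (n + 1) 1) :=
    tup_mem_supp fun i j =>
      (Metric.dist_le_diam_of_mem (bounded_stdSimplex (ι := Fin (n + 1))) (vert n i).2
        (vert n j).2).trans diam_stdSimplex_le
  refine Finsupp.supported_mono (fun v hv => ?_) (sdIter_mesh zero_le_one k hmesh)
  obtain ⟨i, hi⟩ := hball (v 0) (Set.mem_univ _)
  refine ⟨Metric.ball (v 0 : Fin (n + 1) → ℝ) δ, convex_ball _ _, fun j => ?_, ?_⟩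
  · have := hv j 0
    rw [mul_one] at this
    exact lt_of_le_of_lt this hk
  · cases i
    · exact Or.inr fun p hp => hi (show dist p (v 0) < δ from hp)
    · exact Or.inl fun p hp => hi (show dist p (v 0) < δ from hp)

open Classical in
/-- A number of subdivisions which makes `σ` and all its faces small. -/
def numSd (U V : Set Y) : ∀ n : ℕ, SingSimplex n Y → ℕ
  | 0, σ => sInf {k | IsFine U V σ k}
  | n + 1, σ => max (sInf {k | IsFine U V σ k})
      (Finset.univ.sup fun j : Fin (n + 2) => numSd U V n (σ.comp (faceMap n j)))

theorem isFine_numSd (hU : IsOpen U) (hV : IsOpen V) (hUV : U ∪ V = Set.univ) {n : ℕ}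
    (σ : SingSimplex n Y) : IsFine U V σ (numSd U V n σ) := by
  have h : IsFine U V σ (sInf {k | IsFine U V σ k}) := Nat.sInf_mem (exists_isFine hU hV hUV σ)
  cases n with
  | zero => exact h
  | succ n => exact h.mono (le_max_left _ _)

theorem numSd_face_le {n : ℕ} (σ : SingSimplex (n + 1) Y) (j : Fin (n + 2)) :
    numSd U V n (σ.comp (faceMap n j)) ≤ numSd U V (n + 1) σ :=
  (Finset.le_sup (f := fun j : Fin (n + 2) => numSd U V n (σ.comp (faceMap n j)))
    (Finset.mem_univ j)).trans (le_max_right _ _)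

theorem IsSmall.face {n : ℕ} {σ : SingSimplex (n + 1) Y} (h : IsSmall U V σ) (j : Fin (n + 2)) :
    IsSmall U V (σ.comp (faceMap n j)) :=
  h.imp (fun h _ => h _) fun h _ => h _

theorem numSd_of_isSmall {n : ℕ} {σ : SingSimplex n Y} (h : IsSmall U V σ) :
    numSd U V n σ = 0 := by
  have h0 : ∀ {n : ℕ} {σ : SingSimplex n Y}, IsSmall U V σ →
      sInf {k | IsFine U V σ k} = 0 := by
    intro n σ h
    refine Nat.sInf_eq_zero.2 (Or.inl (tup_mem_supp ⟨Set.univ, convex_univ, fun _ => trivial, ?_⟩))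
    exact h.imp (fun h p _ => h p) fun h p _ => h p
  induction n with
  | zero => exact h0 h
  | succ n ih =>
    have : (Finset.univ.sup fun j : Fin (n + 2) => numSd U V n (σ.comp (faceMap n j))) = 0 :=
      (Finset.sup_eq_bot_iff _ _).2 fun j _ => ih (h.face j)
    rw [numSd, h0 h, this, max_self]

/-- Evaluation of the pullback of a cochain along `σ` on chains of affine simplices. -/
def pair {n m : ℕ} (c : SingCochain m Y A) (σ : SingSimplex n Y) :
    TupleChain (m + 1) (stdSimplex ℝ (Fin (n + 1))) →ₗ[ℤ] A :=
  lext fun v => c (σ.comp (affSimplex v))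

theorem pair_tup {n m : ℕ} (c : SingCochain m Y A) (σ : SingSimplex n Y)
    (v : Fin (m + 1) → stdSimplex ℝ (Fin (n + 1))) :
    pair c σ (tup v) = c (σ.comp (affSimplex v)) := lext_tup _ _

theorem pair_vert {n : ℕ} (c : SingCochain n Y A) (σ : SingSimplex n Y) :
    pair c σ (tup (vert n)) = c σ := by
  rw [pair_tup, affSimplex_vert, ContinuousMap.comp_id]

theorem pair_coboundary {n m : ℕ} (c : SingCochain m Y A) (σ : SingSimplex n Y)
    (x : TupleChain (m + 2) (stdSimplex ℝ (Fin (n + 1)))) :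
    pair (coboundary m Y A c) σ x = pair c σ (bdry (m + 1) _ x) := by
  have : pair (coboundary m Y A c) σ =
      (pair c σ).comp (bdry (m + 1) (stdSimplex ℝ (Fin (n + 1)))) := by
    refine tupleHom_ext fun v => ?_
    rw [LinearMap.comp_apply, pair_tup, bdry_tup, map_sum]
    change ∑ j : Fin (m + 2), (-1 : ℤ) ^ (j : ℕ) • c ((σ.comp (affSimplex v)).comp (faceMap m j)) =
      _
    refine Finset.sum_congr rfl fun j _ => ?_
    rw [map_zsmul, pair_tup, ContinuousMap.comp_assoc, affSimplex_comp_face]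
  exact LinearMap.congr_fun this x

theorem pair_face {n m : ℕ} (c : SingCochain m Y A) (σ : SingSimplex (n + 1) Y) (j : Fin (n + 2))
    (x : TupleChain (m + 1) (stdSimplex ℝ (Fin (n + 1)))) :
    pair c (σ.comp (faceMap n j)) x = pair c σ (tupMap (m + 1) (faceMap n j) x) := by
  have : pair c (σ.comp (faceMap n j)) = (pair c σ).comp (tupMap (m + 1) (faceMap n j)) := by
    refine tupleHom_ext fun v => ?_
    rw [LinearMap.comp_apply, pair_tup, tupMap_tup, pair_tup, ContinuousMap.comp_assoc,
      faceMap_affSimplex]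
  exact LinearMap.congr_fun this x

theorem coboundary_coboundary (n : ℕ) (c : SingCochain n Y A) :
    coboundary (n + 1) Y A (coboundary n Y A c) = 0 := by
  funext σ
  rw [← pair_vert (coboundary (n + 1) Y A _) σ, pair_coboundary, pair_coboundary, bdry_bdry,
    map_zero, Pi.zero_apply]

theorem pair_good {n m : ℕ} {c : SingCochain m Y A} (hc : ∀ τ, IsSmall U V τ → c τ = 0)
    {σ : SingSimplex n Y} {x : TupleChain (m + 1) (stdSimplex ℝ (Fin (n + 1)))}
    (hx : x ∈ supp (goodSet U V σ (m + 1))) : pair c σ x = 0 := by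
  have := map_mem_of_supp (pair c σ) (N := ⊥) (fun v hv => ?_) hx
  · exact this
  · obtain ⟨C, hC, hvC, hσ⟩ := hv
    rw [pair_tup]
    refine hc _ ?_
    exact hσ.imp (fun h x => h _ (affSimplex_mem hC hvC x)) fun h x => h _ (affSimplex_mem hC hvC x)

/-- The subdivision homotopy on cochains. -/
def sdDual (U V : Set Y) (n : ℕ) (c : SingCochain (n + 1) Y A) : SingCochain n Y A :=
  fun σ => pair c σ (sdSum bary (n + 1) (numSd U V n σ) (tup (vert n)))

theorem sdDual_of_isSmall {n : ℕ} (c : SingCochain (n + 1) Y A) {σ : SingSimplex n Y}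
    (h : IsSmall U V σ) : sdDual U V n c σ = 0 := by
  simp [sdDual, numSd_of_isSmall h, sdSum]

theorem sdDual_zero (n : ℕ) : sdDual U V n (0 : SingCochain (n + 1) Y A) = 0 := by
  funext σ
  exact pair_good (U := Set.univ) (V := Set.univ) (fun _ _ => rfl)
    ((Finsupp.mem_supported _ _).2 fun v _ =>
      ⟨Set.univ, convex_univ, fun _ => trivial, Or.inl fun _ _ => trivial⟩)

theorem eq_of_vanish_on_small (hU : IsOpen U) (hV : IsOpen V) (hUV : U ∪ V = Set.univ) {n : ℕ}
    {c : SingCochain (n + 1) Y A} (hc : ∀ τ, IsSmall U V τ → c τ = 0) :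
    c = coboundary n Y A (sdDual U V n c) + sdDual U V (n + 1) (coboundary (n + 1) Y A c) := by
  funext σ
  set M := numSd U V (n + 1) σ with hM
  have h1 : sdDual U V (n + 1) (coboundary (n + 1) Y A c) σ =
      c σ - pair c σ (sdSum bary (n + 1) M (bdry (n + 1) _ (tup (vert (n + 1))))) := by
    rw [sdDual, pair_coboundary, bdry_sdSum, map_sub, map_sub, pair_vert,
      pair_good hc (isFine_numSd hU hV hUV σ), sub_zero]
  have h2 : ∀ j : Fin (n + 2), pair c σ (sdSum bary (n + 1) M (tup (vert (n + 1) ∘ j.succAbove))) =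
      sdDual U V n c (σ.comp (faceMap n j)) := by
    intro j
    rw [← faceMap_vert, ← tupMap_tup, ← tupMap_sdSum (fun _ => faceMap_bary j), ← pair_face]
    unfold sdDual
    have hle : numSd U V n (σ.comp (faceMap n j)) ≤ M := numSd_face_le σ j
    have hf := isFine_numSd hU hV hUV (σ.comp (faceMap n j))
    clear_value M
    clear hM h1
    induction M, hle using Nat.le_induction with
    | base => rfl
    | succ l hl ih =>
      rw [sdSum_succ, map_add, ih, pair_good hc (sdHtpy_good (hf.mono hl)), add_zero]
  have h3 : pair c σ (sdSum bary (n + 1) M (bdry (n + 1) _ (tup (vert (n + 1))))) =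
      coboundary n Y A (sdDual U V n c) σ := by
    rw [bdry_tup, map_sum, map_sum]
    refine Finset.sum_congr rfl fun j _ => ?_
    rw [map_zsmul, map_zsmul, h2]
  rw [Pi.add_apply, h1, h3]
  abel

/-- A cocycle vanishing on small simplices is a coboundary. -/
theorem coboundary_of_vanish (hU : IsOpen U) (hV : IsOpen V) (hUV : U ∪ V = Set.univ) {n : ℕ}
    {c : SingCochain (n + 1) Y A} (hc : ∀ τ, IsSmall U V τ → c τ = 0)
    (hd : coboundary (n + 1) Y A c = 0) : ∃ b, coboundary n Y A b = c := by
  refine ⟨sdDual U V n c, ?_⟩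
  have := eq_of_vanish_on_small hU hV hUV hc
  rw [hd, sdDual_zero, add_zero] at this
  exact this.symm

/-- A cochain which is a cocycle on small simplices agrees on small simplices with a cocycle. -/
theorem exists_cocycle_of_small (hU : IsOpen U) (hV : IsOpen V) (hUV : U ∪ V = Set.univ) {n : ℕ}
    {c : SingCochain (n + 1) Y A}
    (hd : ∀ τ, IsSmall U V τ → coboundary (n + 1) Y A c τ = 0) :
    ∃ c' : SingCochain (n + 1) Y A, coboundary (n + 1) Y A c' = 0 ∧
      ∀ τ, IsSmall U V τ → c' τ = c τ := by
  refine ⟨c - sdDual U V (n + 1) (coboundary (n + 1) Y A c), ?_, fun τ hτ => ?_⟩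
  · have := eq_of_vanish_on_small hU hV hUV hd
    rw [coboundary_coboundary, sdDual_zero, add_zero] at this
    rw [map_sub, ← this, sub_self]
  · rw [Pi.sub_apply, sdDual_of_isSmall _ hτ, sub_zero]

end Small

/-! ### The Mayer–Vietoris connecting homomorphism of an open cover -/

section MayerVietoris

variable {Y : Type u} [TopologicalSpace Y] {A : Type w} [AddCommGroup A]

/-- The inclusion of a subspace. -/
def inclMap (U : Set Y) : C(U, Y) := ⟨Subtype.val, continuous_subtype_val⟩

/-- The inclusion `U ∩ V → U`. -/
def interLeft (U V : Set Y) : C(↥(U ∩ V), U) :=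
  ⟨Set.inclusion Set.inter_subset_left, continuous_inclusion Set.inter_subset_left⟩

/-- The inclusion `U ∩ V → V`. -/
def interRight (U V : Set Y) : C(↥(U ∩ V), V) :=
  ⟨Set.inclusion Set.inter_subset_right, continuous_inclusion Set.inter_subset_right⟩

/-- The snake lemma relation of the Mayer–Vietoris sequence
`Cᵏ(Y) → Cᵏ(U) ⊕ Cᵏ(V) → Cᵏ(U ∩ V)`, `c ↦ (c|U, c|V)`, `(b₁, b₂) ↦ b₁|U∩V - b₂|U∩V`:
the class `[c]` corresponds to `[z]` if there are cochains `b₁`, `b₂` with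
`z = b₁|U∩V - b₂|U∩V` and `(c|U, c|V) = (d b₁, d b₂)`. -/
def IsMVConnecting (U V : Set Y) (n : ℕ) (a : SingCohomology n ↥(U ∩ V) A)
    (b : SingCohomology (n + 1) Y A) : Prop :=
  ∃ (z : cocycles n ↥(U ∩ V) A) (b₁ : SingCochain n U A) (b₂ : SingCochain n V A)
    (c : cocycles (n + 1) Y A),
    cohClass z = a ∧ cohClass c = b ∧
    cochainMap n A (interLeft U V) b₁ - cochainMap n A (interRight U V) b₂ = z ∧
    cochainMap (n + 1) A (inclMap U) c = coboundary n U A b₁ ∧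
    cochainMap (n + 1) A (inclMap V) c = coboundary n V A b₂

theorem IsMVConnecting.add {U V : Set Y} {n : ℕ} {a a' : SingCohomology n ↥(U ∩ V) A}
    {b b' : SingCohomology (n + 1) Y A} (h : IsMVConnecting U V n a b)
    (h' : IsMVConnecting U V n a' b') : IsMVConnecting U V n (a + a') (b + b') := by
  obtain ⟨z, b₁, b₂, c, rfl, rfl, hz, hU, hV⟩ := h
  obtain ⟨z', b₁', b₂', c', rfl, rfl, hz', hU', hV'⟩ := h'
  refine ⟨z + z', b₁ + b₁', b₂ + b₂', c + c', rfl, rfl, ?_, ?_, ?_⟩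
  · rw [map_add, map_add, AddSubgroup.coe_add, ← hz, ← hz']
    abel
  · rw [AddSubgroup.coe_add, map_add, map_add, hU, hU']
  · rw [AddSubgroup.coe_add, map_add, map_add, hV, hV']

theorem IsMVConnecting.neg {U V : Set Y} {n : ℕ} {a : SingCohomology n ↥(U ∩ V) A}
    {b : SingCohomology (n + 1) Y A} (h : IsMVConnecting U V n a b) :
    IsMVConnecting U V n (-a) (-b) := by
  obtain ⟨z, b₁, b₂, c, rfl, rfl, hz, hU, hV⟩ := h
  refine ⟨-z, -b₁, -b₂, -c, rfl, rfl, ?_, ?_, ?_⟩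
  · rw [map_neg, map_neg, AddSubgroup.coe_neg, ← hz]
    abel
  · rw [AddSubgroup.coe_neg, map_neg, map_neg, hU]
  · rw [AddSubgroup.coe_neg, map_neg, map_neg, hV]

/-- A singular simplex with image in `U` as a simplex of `U`. -/
def toSub {U : Set Y} {n : ℕ} (σ : SingSimplex n Y) (h : ∀ x, σ x ∈ U) : SingSimplex n U :=
  ⟨fun x => ⟨σ x, h x⟩, σ.continuous.subtype_mk h⟩

open Classical in
/-- Extension by zero of a cochain on a subspace. -/
def extZero {U : Set Y} {n : ℕ} (b : SingCochain n U A) : SingCochain n Y A :=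
  fun σ => if h : ∀ x, σ x ∈ U then b (toSub σ h) else 0

theorem extZero_of_mem {U : Set Y} {n : ℕ} (b : SingCochain n U A) {σ : SingSimplex n Y}
    (h : ∀ x, σ x ∈ U) : extZero b σ = b (toSub σ h) := dif_pos h

theorem extZero_of_not_mem {U : Set Y} {n : ℕ} (b : SingCochain n U A) {σ : SingSimplex n Y}
    (h : ¬ ∀ x, σ x ∈ U) : extZero b σ = 0 := dif_neg h

theorem coboundary_extZero {U : Set Y} {n : ℕ} (b : SingCochain n U A)
    {σ : SingSimplex (n + 1) Y} (h : ∀ x, σ x ∈ U) :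
    coboundary n Y A (extZero b) σ = coboundary n U A b (toSub σ h) := by
  rw [coboundary_apply, coboundary_apply]
  refine Finset.sum_congr rfl fun j _ => ?_
  rw [extZero_of_mem b (σ := σ.comp (faceMap n j)) fun x => h _]
  rfl

theorem cochainMap_inclMap_extZero {U : Set Y} {n : ℕ} (b : SingCochain n U A) :
    cochainMap n A (inclMap U) (extZero b) = b := by
  funext σ
  exact extZero_of_mem b (σ := (inclMap U).comp σ) fun x => (σ x).2

theorem IsMVConnecting.eq_zero {U V : Set Y} (hU : IsOpen U) (hV : IsOpen V)
    (hUV : U ∪ V = Set.univ) {n : ℕ} {b : SingCohomology (n + 1) Y A}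
    (h : IsMVConnecting U V n (0 : SingCohomology n ↥(U ∩ V) A) b) : b = 0 := by
  obtain ⟨z, b₁, b₂, c, ha, rfl, hz, hcU, hcV⟩ := h
  have hz0 : (z : SingCochain n ↥(U ∩ V) A) ∈ coboundaries n ↥(U ∩ V) A :=
    (QuotientAddGroup.eq_zero_iff z).1 ha
  obtain ⟨b₁', hd, hi⟩ : ∃ b₁' : SingCochain n U A, coboundary n U A b₁' = coboundary n U A b₁ ∧
      cochainMap n A (interLeft U V) b₁' = cochainMap n A (interRight U V) b₂ := by
    cases n with
    | zero =>
      refine ⟨b₁, rfl, sub_eq_zero.1 ?_⟩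
      rw [hz]
      exact hz0
    | succ m =>
      obtain ⟨y, hy⟩ := hz0
      let y' : SingCochain m U A := cochainMap m A (inclMap U)
        (extZero (cochainMap m A (⟨fun x => x, continuous_id⟩ : C(↥(U ∩ V), ↥(U ∩ V))) y))
      have hy' : cochainMap m A (interLeft U V) y' = y := by
        funext σ
        exact extZero_of_mem _ (σ := (inclMap U).comp ((interLeft U V).comp σ)) fun x => (σ x).2
      refine ⟨b₁ - coboundary m U A y', ?_, ?_⟩
      · rw [map_sub, coboundary_coboundary, sub_zero]
      · rw [map_sub, ← coboundary_cochainMap, hy', hy, ← hz]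
        abel
  classical
  let f : SingCochain n Y A := fun σ => if ∀ x, σ x ∈ U then extZero b₁' σ else extZero b₂ σ
  have hfU : cochainMap n A (inclMap U) f = b₁' := by
    funext σ
    have : ∀ x, ((inclMap U).comp σ) x ∈ U := fun x => (σ x).2
    change (if ∀ x, ((inclMap U).comp σ) x ∈ U then _ else _) = _
    rw [if_pos this, extZero_of_mem b₁' this]
    rfl
  have hfV : cochainMap n A (inclMap V) f = b₂ := by
    funext σ
    have hV' : ∀ x, ((inclMap V).comp σ) x ∈ V := fun x => (σ x).2
    change (if ∀ x, ((inclMap V).comp σ) x ∈ U then _ else _) = _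
    split_ifs with h
    · rw [extZero_of_mem b₁' h]
      exact congrFun hi (toSub ((inclMap V).comp σ) fun x => ⟨h x, hV' x⟩)
    · rw [extZero_of_mem b₂ hV']
      rfl
  have hvan : ∀ τ : SingSimplex (n + 1) Y, IsSmall U V τ →
      ((c : SingCochain (n + 1) Y A) - coboundary n Y A f) τ = 0 := by
    rintro τ (h | h)
    · have := congrFun hcU (toSub τ h)
      rw [← hd, ← hfU, coboundary_cochainMap] at this
      exact sub_eq_zero.2 this
    · have := congrFun hcV (toSub τ h)
      rw [← hfV, coboundary_cochainMap] at this
      exact sub_eq_zero.2 this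
  have hc0 : coboundary (n + 1) Y A (c : SingCochain (n + 1) Y A) = 0 := c.2
  obtain ⟨e, he⟩ := coboundary_of_vanish hU hV hUV hvan
    (by rw [map_sub, coboundary_coboundary, sub_zero, hc0])
  refine (QuotientAddGroup.eq_zero_iff c).2 ⟨e + f, ?_⟩
  rw [map_add, he, sub_add_cancel]
  rfl

theorem exists_isMVConnecting {U V : Set Y} (hU : IsOpen U) (hV : IsOpen V)
    (hUV : U ∪ V = Set.univ) (n : ℕ) (a : SingCohomology n ↥(U ∩ V) A) :
    ∃ b : SingCohomology (n + 1) Y A, IsMVConnecting U V n a b := by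
  obtain ⟨z, rfl⟩ := QuotientAddGroup.mk_surjective a
  have hz : coboundary n ↥(U ∩ V) A z = 0 := z.2
  let b₁ : SingCochain n U A := cochainMap n A (inclMap U) (extZero (z : SingCochain n ↥(U ∩ V) A))
  have hb₁ : cochainMap n A (interLeft U V) b₁ = z := by
    funext σ
    exact extZero_of_mem _ (σ := (inclMap U).comp ((interLeft U V).comp σ)) fun x => (σ x).2
  let e : SingCochain (n + 1) Y A := extZero (coboundary n U A b₁)
  have heU : ∀ σ : SingSimplex (n + 1) Y, ∀ h : ∀ x, σ x ∈ U,
      e σ = coboundary n U A b₁ (toSub σ h) := fun σ h => extZero_of_mem _ h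
  have heV : ∀ σ : SingSimplex (n + 1) Y, (∀ x, σ x ∈ V) → e σ = 0 := by
    intro σ hσ
    by_cases h : ∀ x, σ x ∈ U
    · rw [heU σ h]
      have := congrFun hz (toSub σ fun x => ⟨h x, hσ x⟩)
      rw [← hb₁, coboundary_cochainMap] at this
      exact this
    · exact extZero_of_not_mem _ h
  obtain ⟨c, hc, hce⟩ := exists_cocycle_of_small hU hV hUV (c := e) (by
    rintro τ (h | h)
    · have := coboundary_extZero (coboundary n U A b₁) h
      rw [coboundary_coboundary] at this
      exact this
    · rw [coboundary_apply]
      refine Finset.sum_eq_zero fun j _ => ?_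
      rw [heV (τ.comp (faceMap (n + 1) j)) fun x => h _, smul_zero])
  refine ⟨cohClass ⟨c, hc⟩, z, b₁, 0, ⟨c, hc⟩, rfl, rfl, ?_, ?_, ?_⟩
  · rw [hb₁, map_zero, sub_zero]
  · funext σ
    have h : ∀ x, ((inclMap U).comp σ) x ∈ U := fun x => (σ x).2
    exact (hce _ (Or.inl h)).trans (heU _ h)
  · funext σ
    have h : ∀ x, ((inclMap V).comp σ) x ∈ V := fun x => (σ x).2
    rw [map_zero]
    exact (hce _ (Or.inr h)).trans (heV _ h)

theorem existsUnique_isMVConnecting {U V : Set Y} (hU : IsOpen U) (hV : IsOpen V)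
    (hUV : U ∪ V = Set.univ) (n : ℕ) (a : SingCohomology n ↥(U ∩ V) A) :
    ∃! b : SingCohomology (n + 1) Y A, IsMVConnecting U V n a b := by
  obtain ⟨b, hb⟩ := exists_isMVConnecting hU hV hUV n a
  refine ⟨b, hb, fun b' hb' => ?_⟩
  have := hb'.add hb.neg
  rw [add_neg_cancel] at this
  exact add_neg_eq_zero.1 (this.eq_zero hU hV hUV)

/-- The connecting homomorphism `Hⁿ(U ∩ V; A) → Hⁿ⁺¹(Y; A)` of the Mayer–Vietoris sequence of an
open cover `Y = U ∪ V`. -/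
def coverConnecting (A : Type w) [AddCommGroup A] {U V : Set Y} (hU : IsOpen U) (hV : IsOpen V)
    (hUV : U ∪ V = Set.univ) (n : ℕ) :
    SingCohomology n ↥(U ∩ V) A →+ SingCohomology (n + 1) Y A :=
  AddMonoidHom.mk' (fun a => (existsUnique_isMVConnecting hU hV hUV n a).choose) fun a a' =>
    ((existsUnique_isMVConnecting hU hV hUV n (a + a')).choose_spec.2 _
      ((existsUnique_isMVConnecting hU hV hUV n a).choose_spec.1.add
        (existsUnique_isMVConnecting hU hV hUV n a').choose_spec.1)).symm

theorem coverConnecting_eq_iff {U V : Set Y} (hU : IsOpen U) (hV : IsOpen V)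
    (hUV : U ∪ V = Set.univ) (n : ℕ) (a : SingCohomology n ↥(U ∩ V) A)
    (b : SingCohomology (n + 1) Y A) :
    coverConnecting A hU hV hUV n a = b ↔ IsMVConnecting U V n a b := by
  refine ⟨?_, fun h => ((existsUnique_isMVConnecting hU hV hUV n a).choose_spec.2 _ h).symm⟩
  rintro rfl
  exact (existsUnique_isMVConnecting hU hV hUV n a).choose_spec.1

end MayerVietoris

/-! ### Double mapping cylinders -/

section DoubleMappingCylinder

open scoped unitInterval

variable {L B₁ B₂ Z : Type u} [TopologicalSpace L] [TopologicalSpace B₁] [TopologicalSpace B₂]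
  [TopologicalSpace Z]

/-- The gluing relation of the double mapping cylinder of `B₁ ← L → B₂`. -/
inductive DMCRel (f : C(L, B₁)) (g : C(L, B₂)) :
    B₁ ⊕ (L × I) ⊕ B₂ → B₁ ⊕ (L × I) ⊕ B₂ → Prop
  | left (l : L) : DMCRel f g (Sum.inr (Sum.inl (l, 0))) (Sum.inl (f l))
  | right (l : L) : DMCRel f g (Sum.inr (Sum.inl (l, 1))) (Sum.inr (Sum.inr (g l)))

/-- The double mapping cylinder of `B₁ ← L → B₂`: the quotient of `B₁ ⊔ (L × [0,1]) ⊔ B₂` by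
`(l, 0) ∼ f l` and `(l, 1) ∼ g l`, with the quotient topology. -/
def DMC (f : C(L, B₁)) (g : C(L, B₂)) : Type u := Quot (DMCRel f g)

instance (f : C(L, B₁)) (g : C(L, B₂)) : TopologicalSpace (DMC f g) :=
  inferInstanceAs (TopologicalSpace (Quot (DMCRel f g)))

namespace DMC

variable (f : C(L, B₁)) (g : C(L, B₂))

/-- The quotient map. -/
def mk : C(B₁ ⊕ (L × I) ⊕ B₂, DMC f g) := ⟨Quot.mk _, continuous_quot_mk⟩

/-- The inclusion of `B₁`. -/
def i₁ : C(B₁, DMC f g) := (mk f g).comp ⟨Sum.inl, continuous_inl⟩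

/-- The inclusion of `B₂`. -/
def i₂ : C(B₂, DMC f g) :=
  (mk f g).comp ⟨fun b => Sum.inr (Sum.inr b), continuous_inr.comp continuous_inr⟩

/-- The canonical map from the cylinder `L × [0,1]`. -/
def cyl : C(L × I, DMC f g) :=
  (mk f g).comp ⟨fun p => Sum.inr (Sum.inl p), continuous_inr.comp continuous_inl⟩

/-- The coordinate in `[0,1]`, equal to `0` on `B₁` and to `1` on `B₂`. -/
def height : C(DMC f g, I) where
  toFun := Quot.lift (Sum.elim (fun _ => 0) (Sum.elim Prod.snd fun _ => 1)) (by
    rintro _ _ (l | l) <;> rfl)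
  continuous_toFun := continuous_quot_lift _
    (continuous_const.sumElim (continuous_snd.sumElim continuous_const))

variable {f g}

/-- The map induced by `p₁ : B₁ → Z` and `p₂ : B₂ → Z` with `p₁ ∘ f = p₂ ∘ g`, through the constant
homotopy on the cylinder. -/
def whisker (p₁ : C(B₁, Z)) (p₂ : C(B₂, Z)) (h : ∀ l, p₁ (f l) = p₂ (g l)) : C(DMC f g, Z) where
  toFun := Quot.lift (Sum.elim p₁ (Sum.elim (fun q => p₁ (f q.1)) p₂)) (by
    rintro _ _ (l | l)
    · rfl
    · exact h l)
  continuous_toFun := continuous_quot_lift _ (p₁.continuous.sumElim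
    (((p₁.comp f).continuous.comp continuous_fst).sumElim p₂.continuous))

variable (f g)

/-- The open neighbourhood of `B₁` where the height is less than `1`. -/
def lower : Set (DMC f g) := {y | height f g y < 1}

/-- The open neighbourhood of `B₂` where the height is positive. -/
def upper : Set (DMC f g) := {y | 0 < height f g y}

theorem isOpen_lower : IsOpen (lower f g) :=
  isOpen_lt (height f g).continuous continuous_const

theorem isOpen_upper : IsOpen (upper f g) :=
  isOpen_lt continuous_const (height f g).continuous

theorem lower_union_upper : lower f g ∪ upper f g = Set.univ := by
  refine Set.eq_univ_of_forall fun y => ?_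
  rcases eq_or_ne (height f g y) 0 with h | h
  · exact Or.inl (show height f g y < 1 by rw [h]; exact zero_lt_one)
  · exact Or.inr (unitInterval.pos_iff_ne_zero.2 h)

open Classical in
/-- The projection `(l, t) ↦ l` of the open cylinder `L × (0,1)`, undefined elsewhere. -/
def neckOption : DMC f g → Option L :=
  Quot.lift (Sum.elim (fun _ => none)
    (Sum.elim (fun p => if 0 < p.2 ∧ p.2 < 1 then some p.1 else none) fun _ => none)) (by
    rintro _ _ (l | l) <;> simp)

theorem neckOption_isSome (y : ↥(lower f g ∩ upper f g)) : (neckOption f g y).isSome := by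
  obtain ⟨y, h1, h0⟩ := y
  induction y using Quot.ind with | mk s => ?_
  rcases s with b | p | b
  · exact absurd (show (0 : I) < 0 from h0) (lt_irrefl _)
  · have hp : 0 < p.2 ∧ p.2 < 1 := ⟨h0, h1⟩
    change (if 0 < p.2 ∧ p.2 < 1 then some p.1 else none).isSome
    rw [if_pos hp]
    rfl
  · exact absurd (show (1 : I) < 1 from h1) (lt_irrefl _)

theorem isOpen_neckOption {O : Set L} (hO : IsOpen O) :
    IsOpen {y : DMC f g | ∃ l ∈ O, neckOption f g y = some l} := by
  change IsOpen (Quot.mk (DMCRel f g) ⁻¹' {y : DMC f g | ∃ l ∈ O, neckOption f g y = some l})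
  refine isOpen_sum_iff.2 ⟨?_, isOpen_sum_iff.2 ⟨?_, ?_⟩⟩
  · convert isOpen_empty
    refine Set.eq_empty_of_forall_notMem ?_
    rintro b ⟨l, -, hl⟩
    exact Option.some_ne_none l hl.symm
  · convert (hO.preimage (continuous_fst (X := L) (Y := I))).inter
      ((isOpen_lt continuous_const (continuous_snd (X := L) (Y := I))).inter
        (isOpen_lt (continuous_snd (X := L) (Y := I)) continuous_const) :
        IsOpen ({p : L × I | 0 < p.2} ∩ {p : L × I | p.2 < 1})) using 1
    ext p
    change (∃ l ∈ O, (if 0 < p.2 ∧ p.2 < 1 then some p.1 else none) = some l) ↔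
      p.1 ∈ O ∧ (0 < p.2 ∧ p.2 < 1)
    split_ifs with h
    · simp [h]
    · simp [h]
  · convert isOpen_empty
    refine Set.eq_empty_of_forall_notMem ?_
    rintro b ⟨l, -, hl⟩
    exact Option.some_ne_none l hl.symm

/-- The intersection of the two neighbourhoods is the open cylinder `L × (0,1)`; this is its
projection to `L`, a homotopy equivalence. -/
def neck : C(↥(lower f g ∩ upper f g), L) where
  toFun y := (neckOption f g y).get (neckOption_isSome f g y)
  continuous_toFun := by
    refine continuous_def.2 fun O hO => ?_
    convert (isOpen_neckOption f g hO).preimage continuous_subtype_val using 1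
    ext y
    constructor
    · intro h
      exact ⟨_, h, (Option.some_get _).symm⟩
    · rintro ⟨l, hl, h⟩
      change (neckOption f g y).get (neckOption_isSome f g y) ∈ O
      simpa [h] using hl

theorem neck_cyl (l : L) (t : I) (h : cyl f g (l, t) ∈ lower f g ∩ upper f g) :
    neck f g ⟨cyl f g (l, t), h⟩ = l := by
  have ht : 0 < t ∧ t < 1 := ⟨h.2, h.1⟩
  refine (Option.get_of_eq_some _ ?_)
  change (if 0 < t ∧ t < 1 then some l else none) = some l
  exact if_pos ht

/-- The connecting homomorphism `Hⁿ(L; A) → Hⁿ⁺¹(DMC f g; A)` of the Mayer–Vietoris sequence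
`… → Hⁿ(DMC f g) → Hⁿ(B₁) ⊕ Hⁿ(B₂) → Hⁿ(L) → Hⁿ⁺¹(DMC f g) → …` with the maps
`(i₁^*, i₂^*)` and `f^* - g^*`. The neighbourhoods `lower` and `upper` deformation retract to `B₁`
and `B₂`, and their intersection projects to `L` by the homotopy equivalence `neck`, so that this
is the Mayer–Vietoris sequence of the open cover by these two neighbourhoods. -/
def connecting (A : Type w) [AddCommGroup A] (n : ℕ) :
    SingCohomology n L A →+ SingCohomology (n + 1) (DMC f g) A :=
  (coverConnecting A (isOpen_lower f g) (isOpen_upper f g) (lower_union_upper f g) n).comp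
    (cohMap n A (neck f g))

end DMC

end DoubleMappingCylinder

/-! ### Path and loop spaces and the fibrewise join -/

section FibrewiseJoin

open scoped unitInterval

variable (X : Type u) [TopologicalSpace X]

/-- The path space `PX = C([0,1], X)`, with the compact-open topology. -/
abbrev PathSp : Type u := C(I, X)

/-- The free loop space `LX = C(S¹, X)`, with `S¹ = ℝ/ℤ` and the compact-open topology. -/
abbrev LoopSp : Type u := C(UnitAddCircle, X)

/-- The end point map `π : PX → X × X`, `γ ↦ (γ(0), γ(1))`. -/
def endpoints : C(PathSp X, X × X) where
  toFun γ := (γ 0, γ 1)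
  continuous_toFun := (continuous_eval_const (0 : I)).prodMk
    (continuous_eval_const (1 : I))

/-- The path `t ↦ t / 2` in `S¹ = ℝ/ℤ`. -/
def halfFwd : C(I, UnitAddCircle) where
  toFun t := (((t : ℝ) / 2 : ℝ) : UnitAddCircle)
  continuous_toFun := (AddCircle.continuous_mk' (1 : ℝ)).comp (by fun_prop)

/-- The path `t ↦ 1 - t / 2` in `S¹ = ℝ/ℤ`. -/
def halfBwd : C(I, UnitAddCircle) where
  toFun t := ((1 - (t : ℝ) / 2 : ℝ) : UnitAddCircle)
  continuous_toFun := (AddCircle.continuous_mk' (1 : ℝ)).comp (by fun_prop)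

/-- `r₁ : LX → PX`, `(r₁ γ)(t) = γ(t / 2)`. -/
def r₁ : C(LoopSp X, PathSp X) where
  toFun γ := γ.comp halfFwd
  continuous_toFun := ContinuousMap.continuous_precomp halfFwd

/-- `r₂ : LX → PX`, `(r₂ γ)(t) = γ(1 - t / 2)`. -/
def r₂ : C(LoopSp X, PathSp X) where
  toFun γ := γ.comp halfBwd
  continuous_toFun := ContinuousMap.continuous_precomp halfBwd

theorem endpoints_r (γ : LoopSp X) : endpoints X (r₁ X γ) = endpoints X (r₂ X γ) := by
  have h0 : halfFwd 0 = halfBwd 0 := by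
    change (((0 : ℝ) / 2 : ℝ) : UnitAddCircle) = ((1 - (0 : ℝ) / 2 : ℝ) : UnitAddCircle)
    rw [zero_div, sub_zero, QuotientAddGroup.mk_zero]
    exact (AddCircle.coe_period (1 : ℝ)).symm
  have h1 : halfFwd 1 = halfBwd 1 := by
    change (((1 : ℝ) / 2 : ℝ) : UnitAddCircle) = ((1 - (1 : ℝ) / 2 : ℝ) : UnitAddCircle)
    norm_num
  exact Prod.ext (congrArg γ h0) (congrArg γ h1)

/-- The fibrewise join `P₂X` of `π : PX → X × X` with itself: the double mapping cylinder of
`r₁, r₂ : LX → PX`. -/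
abbrev FibJoin : Type u := DMC (r₁ X) (r₂ X)

/-- The projection `p₂ : P₂X → X × X`, equal to `π` on both copies of `PX` and constant along the
cylinder coordinate. -/
def p₂ : C(FibJoin X, X × X) := DMC.whisker (endpoints X) (endpoints X) (endpoints_r X)

theorem p₂_comp_i₁ : (p₂ X).comp (DMC.i₁ (r₁ X) (r₂ X)) = endpoints X := rfl

theorem p₂_comp_i₂ : (p₂ X).comp (DMC.i₂ (r₁ X) (r₂ X)) = endpoints X := rfl

/-- The diagonal map. -/
def diag : C(X, X × X) := ⟨fun x => (x, x), continuous_id.prodMk continuous_id⟩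

variable {X}

/-- A class on `X × X` is a zero-divisor if its restriction to the diagonal vanishes. -/
def IsZeroDivisor {A : Type w} [AddCommGroup A] {n : ℕ} (u : SingCohomology n (X × X) A) : Prop :=
  u ∈ (cohMap n A (diag X)).ker

end FibrewiseJoin

end MVJoin

end

/-! Two facts are combined. Every path contracts to its starting point, so `PathSp X` is homotopy
equivalent to `X`, and under this equivalence `endpoints X` becomes `diag X`. Hence `u` restricts to
zero on the diagonal exactly when its pullback along `endpoints X` vanishes
(`isZeroDivisor_iff_endpoints`). On the other hand, exactness of the Mayer–Vietoris sequence says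
that the image of the connecting homomorphism consists of the classes which die on both ends of the
double mapping cylinder, and `p₂ X` restricts to `endpoints X` on each end.

Since `DMC.connecting` is built from the open cover by `lower` and `upper`, exactness is first
proved for open covers (`mem_range_coverConnecting_iff`) and then transferred to `connecting`. The
transfer needs precomposition with `neck^*` not to shrink the image, which holds because `neck^*` is
surjective (`cohMap_neck_surjective`). The retractions of the two neighbourhoods need not be shown
to be homotopy equivalences: `p₂ X` is constant along the cylinder, so on each neighbourhood it
equals the retraction followed by `endpoints X` on the nose (`whisker_comp_lower`,
`whisker_comp_upper`).

Homotopy invariance of singular cohomology enters twice, for `neck` and for the contraction of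
paths. It is proved by a prism operator on formal tuples of points, in the style of the subdivision
operators. -/

noncomputable section

namespace MVJoin

universe u v w

/-! ### The prism operator on tuples -/

section Prism

variable {K : Type u} {K' : Type v} {E : Type w}

/-- The inclusion `K → K × E` at `e`, on chains. -/
def slice (m : ℕ) (e : E) : TupleChain m K →ₗ[ℤ] TupleChain m (K × E) :=
  tupMap m fun x => (x, e)

/-- The chain homotopy between the inclusions `K → K × E` at `e₀` and at `e₁`. -/
def prism (e₀ e₁ : E) : ∀ m : ℕ, TupleChain m K →ₗ[ℤ] TupleChain (m + 1) (K × E)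
  -- An `m`-tuple spans a simplex of dimension `m - 1`, so index `0` is the augmentation degree,
  -- spanned by the empty tuple.
  | 0 => 0
  -- The chain in brackets is what the boundary of the prism over `v` has to be. It is a cycle by
  -- induction, so coning it off from any point gives a filling. The apex `(v 0, e₀)` is chosen
  -- because it commutes with every map of the base, with no barycentre involved.
  | m + 1 => lext fun v => cone (m + 1) (v 0, e₀)
      (slice (m + 1) e₁ (tup v) - slice (m + 1) e₀ (tup v) - prism e₀ e₁ m (bdry m K (tup v)))

theorem prism_tup (e₀ e₁ : E) {m : ℕ} (v : Fin (m + 1) → K) :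
    prism e₀ e₁ (m + 1) (tup v) = cone (m + 1) (v 0, e₀)
      (slice (m + 1) e₁ (tup v) - slice (m + 1) e₀ (tup v) -
        prism e₀ e₁ m (bdry m K (tup v))) :=
  lext_tup _ _

theorem bdry_slice (e : E) {m : ℕ} (x : TupleChain (m + 1) K) :
    bdry m (K × E) (slice (m + 1) e x) = slice m e (bdry m K x) :=
  (tupMap_bdry _ x).symm

/-- There is only one empty tuple. This starts the induction for `bdry_prism`: in the augmentation
degree both ends of the prism coincide, so the zero homotopy is correct there. -/
theorem slice_zero_eq (e e' : E) (x : TupleChain 0 K) : slice 0 e x = slice 0 e' x := by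
  have : (slice 0 e : TupleChain 0 K →ₗ[ℤ] _) = slice 0 e' := by
    refine tupleHom_ext fun v => ?_
    rw [slice, slice, tupMap_tup, tupMap_tup]
    congr 1
    exact Subsingleton.elim _ _
  exact LinearMap.congr_fun this x

theorem bdry_prism (e₀ e₁ : E) {m : ℕ} (x : TupleChain (m + 1) K) :
    bdry (m + 1) (K × E) (prism e₀ e₁ (m + 1) x) =
      slice (m + 1) e₁ x - slice (m + 1) e₀ x - prism e₀ e₁ m (bdry m K x) := by
  have : (bdry (m + 1) (K × E)).comp (prism e₀ e₁ (m + 1)) =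
      slice (m + 1) e₁ - slice (m + 1) e₀ - (prism e₀ e₁ m).comp (bdry m K) := by
    clear x
    induction m with
    | zero =>
      refine tupleHom_ext fun v => ?_
      simp only [LinearMap.comp_apply, LinearMap.sub_apply]
      rw [prism_tup, bdry_cone]
      simp only [map_sub, bdry_slice, prism, LinearMap.zero_apply, sub_zero]
      rw [slice_zero_eq e₁ e₀]
      simp
    | succ m ih =>
      refine tupleHom_ext fun v => ?_
      -- The induction hypothesis on the cycle `∂v` shows that the chain being coned is itself a
      -- cycle, so the correction term of `bdry_cone` disappears.
      have h := LinearMap.congr_fun ih (bdry (m + 1) K (tup v))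
      simp only [LinearMap.comp_apply, LinearMap.sub_apply, bdry_bdry, map_zero, sub_zero] at h
      simp only [LinearMap.comp_apply, LinearMap.sub_apply]
      rw [prism_tup, bdry_cone]
      simp only [map_sub, bdry_slice, h]
      abel
  exact LinearMap.congr_fun this x

theorem tupMap_slice (f : K → K') (e : E) {m : ℕ} (x : TupleChain m K) :
    tupMap m (Prod.map f id) (slice m e x) = slice m e (tupMap m f x) := by
  have : (tupMap m (Prod.map f id)).comp (slice m e) = (slice m e).comp (tupMap m f) := by
    refine tupleHom_ext fun v => ?_
    simp only [LinearMap.comp_apply, slice, tupMap_tup]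
    rfl
  exact LinearMap.congr_fun this x

/-- The recursion uses only slices, boundaries and the first vertex, all compatible with arbitrary
maps `f`. Applied to face inclusions, it identifies the prism over a face with the corresponding
part of the big prism. -/
theorem tupMap_prism (f : K → K') (e₀ e₁ : E) {m : ℕ} (x : TupleChain m K) :
    tupMap (m + 1) (Prod.map f id) (prism e₀ e₁ m x) = prism e₀ e₁ m (tupMap m f x) := by
  have : (tupMap (m + 1) (Prod.map f id)).comp (prism e₀ e₁ m) =
      (prism e₀ e₁ m).comp (tupMap m f) := by
    clear x
    induction m with
    | zero => ext; simp [prism]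
    | succ m ih =>
      refine tupleHom_ext fun v => ?_
      have h := LinearMap.congr_fun ih (bdry m K (tup v))
      simp only [LinearMap.comp_apply] at h ⊢
      rw [tupMap_tup, prism_tup, prism_tup, tupMap_cone]
      simp only [map_sub]
      rw [h, tupMap_slice, tupMap_slice, tupMap_bdry, tupMap_tup]
      rfl
  exact LinearMap.congr_fun this x

end Prism

/-! ### Homotopy invariance of singular cohomology -/

section Homotopy

variable {X : Type u} {Y : Type v} {A : Type w}
variable [TopologicalSpace X] [TopologicalSpace Y] [AddCommGroup A]

/-- The affine simplex in the prism `Δᴺ × Δ¹` spanned by a tuple of points. -/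
def affPrism {N m : ℕ}
    (v : Fin (m + 1) → stdSimplex ℝ (Fin (N + 1)) × stdSimplex ℝ (Fin (1 + 1))) :
    C(stdSimplex ℝ (Fin (m + 1)), stdSimplex ℝ (Fin (N + 1)) × stdSimplex ℝ (Fin (1 + 1))) :=
  (affSimplex (Prod.fst ∘ v)).prodMk (affSimplex (Prod.snd ∘ v))

theorem affPrism_comp_face {N m : ℕ}
    (v : Fin (m + 2) → stdSimplex ℝ (Fin (N + 1)) × stdSimplex ℝ (Fin (1 + 1)))
    (j : Fin (m + 2)) : (affPrism v).comp (faceMap m j) = affPrism (v ∘ j.succAbove) :=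
  ContinuousMap.ext fun x => Prod.ext
    (DFunLike.congr_fun (affSimplex_comp_face (Prod.fst ∘ v) j) x)
    (DFunLike.congr_fun (affSimplex_comp_face (Prod.snd ∘ v) j) x)

theorem affPrism_face {n m : ℕ} (j : Fin (n + 2))
    (v : Fin (m + 1) → stdSimplex ℝ (Fin (n + 1)) × stdSimplex ℝ (Fin (1 + 1))) :
    ((faceMap n j).prodMap (ContinuousMap.id _)).comp (affPrism v) =
      affPrism (Prod.map (faceMap n j) id ∘ v) :=
  ContinuousMap.ext fun x => Prod.ext
    (DFunLike.congr_fun (faceMap_affSimplex j (Prod.fst ∘ v)) x) rfl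

theorem affSimplex_const {N m : ℕ} (e : stdSimplex ℝ (Fin (N + 1)))
    (x : stdSimplex ℝ (Fin (m + 1))) : affSimplex (fun _ => e) x = e := by
  refine Subtype.ext ?_
  rw [affSimplex_coe, ← Finset.sum_smul, x.2.2, one_smul]

/-- Evaluation of the pullback of a cochain along `H ∘ (σ × id)` on chains of affine simplices. -/
def prismPair {n m : ℕ} (H : C(X × stdSimplex ℝ (Fin (1 + 1)), Y)) (c : SingCochain m Y A)
    (σ : SingSimplex n X) :
    TupleChain (m + 1) (stdSimplex ℝ (Fin (n + 1)) × stdSimplex ℝ (Fin (1 + 1))) →ₗ[ℤ] A :=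
  lext fun v => c (H.comp ((σ.prodMap (ContinuousMap.id _)).comp (affPrism v)))

theorem prismPair_tup {n m : ℕ} (H : C(X × stdSimplex ℝ (Fin (1 + 1)), Y))
    (c : SingCochain m Y A) (σ : SingSimplex n X)
    (v : Fin (m + 1) → stdSimplex ℝ (Fin (n + 1)) × stdSimplex ℝ (Fin (1 + 1))) :
    prismPair H c σ (tup v) =
      c (H.comp ((σ.prodMap (ContinuousMap.id _)).comp (affPrism v))) := lext_tup _ _

/-- A tuple with constant second coordinate `e` and first coordinates the vertices spans the simplex
`x ↦ (x, e)`, so the ends of the prism evaluate to the pullbacks along the ends of the homotopy. -/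
theorem prismPair_slice {n : ℕ} (H : C(X × stdSimplex ℝ (Fin (1 + 1)), Y))
    (c : SingCochain n Y A) (σ : SingSimplex n X) (e : stdSimplex ℝ (Fin (1 + 1))) {f : C(X, Y)}
    (hf : ∀ x, H (x, e) = f x) :
    prismPair H c σ (slice (n + 1) e (tup (vert n))) = cochainMap n A f c σ := by
  rw [slice, tupMap_tup, prismPair_tup]
  refine congrArg c (ContinuousMap.ext fun x => ?_)
  change H (σ (affSimplex (vert n) x), affSimplex (fun _ => e) x) = f (σ x)
  rw [affSimplex_const, affSimplex_vert, hf]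
  rfl

theorem prismPair_coboundary {n m : ℕ} (H : C(X × stdSimplex ℝ (Fin (1 + 1)), Y))
    (c : SingCochain m Y A) (σ : SingSimplex n X)
    (x : TupleChain (m + 2) (stdSimplex ℝ (Fin (n + 1)) × stdSimplex ℝ (Fin (1 + 1)))) :
    prismPair H (coboundary m Y A c) σ x = prismPair H c σ (bdry (m + 1) _ x) := by
  have : prismPair H (coboundary m Y A c) σ = (prismPair H c σ).comp (bdry (m + 1) _) := by
    refine tupleHom_ext fun v => ?_
    rw [LinearMap.comp_apply, prismPair_tup, bdry_tup, map_sum, coboundary_apply]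
    refine Finset.sum_congr rfl fun j _ => ?_
    rw [map_zsmul, prismPair_tup, ← affPrism_comp_face]
    rfl
  exact LinearMap.congr_fun this x

theorem prismPair_face {n m : ℕ} (H : C(X × stdSimplex ℝ (Fin (1 + 1)), Y))
    (c : SingCochain m Y A) (σ : SingSimplex (n + 1) X) (j : Fin (n + 2))
    (x : TupleChain (m + 1) (stdSimplex ℝ (Fin (n + 1)) × stdSimplex ℝ (Fin (1 + 1)))) :
    prismPair H c (σ.comp (faceMap n j)) x =
      prismPair H c σ (tupMap (m + 1) (Prod.map (faceMap n j) id) x) := by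
  have : prismPair H c (σ.comp (faceMap n j)) =
      (prismPair H c σ).comp (tupMap (m + 1) (Prod.map (faceMap n j) id)) := by
    refine tupleHom_ext fun v => ?_
    rw [LinearMap.comp_apply, prismPair_tup, tupMap_tup, prismPair_tup, ← affPrism_face]
    rfl
  exact LinearMap.congr_fun this x

/-- The prism operator on cochains. -/
def prismDual (H : C(X × stdSimplex ℝ (Fin (1 + 1)), Y)) (n : ℕ) (c : SingCochain (n + 1) Y A) :
    SingCochain n X A :=
  fun σ => prismPair H c σ (prism (vert 1 0) (vert 1 1) (n + 1) (tup (vert n)))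

/-- By naturality of the prism, each face of the standard simplex contributes the value of
`prismDual` on the matching face of `σ`, with the sign of the coboundary. -/
theorem prismPair_prism_bdry (H : C(X × stdSimplex ℝ (Fin (1 + 1)), Y)) (n : ℕ)
    (c : SingCochain (n + 1) Y A) (σ : SingSimplex (n + 1) X) :
    prismPair H c σ (prism (vert 1 0) (vert 1 1) (n + 1) (bdry (n + 1) _ (tup (vert (n + 1))))) =
      coboundary n X A (prismDual H n c) σ := by
  rw [bdry_tup, map_sum, map_sum, coboundary_apply]
  refine Finset.sum_congr rfl fun j _ => ?_
  rw [map_zsmul, map_zsmul, ← faceMap_vert, ← tupMap_tup, ← tupMap_prism, ← prismPair_face]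
  rfl

/-- Homotopic maps induce the same homomorphism on singular cohomology. -/
theorem cohMap_eq_of_homotopic (n : ℕ) {f g : C(X, Y)} (h : f.Homotopic g) :
    cohMap n A f = cohMap n A g := by
  -- The homotopy is reversed so that `g` sits at `0` and `f` at `1`: the prism formula, end minus
  -- start, then reads `f^* - g^*`.
  obtain ⟨F⟩ := h.symm
  -- The interval is replaced by the standard 1-simplex, so that affine simplices make sense in both
  -- factors of the prism.
  let H : C(X × stdSimplex ℝ (Fin (1 + 1)), Y) :=
    ⟨fun p => F (stdSimplexHomeomorphUnitInterval p.2, p.1), by fun_prop⟩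
  have hf : ∀ x, H (x, vert 1 1) = f x := fun x => by
    have : stdSimplexHomeomorphUnitInterval (vert 1 1) = 1 := stdSimplexHomeomorphUnitInterval_one
    change F (stdSimplexHomeomorphUnitInterval (vert 1 1), x) = f x
    rw [this, F.apply_one]
  have hg : ∀ x, H (x, vert 1 0) = g x := fun x => by
    have : stdSimplexHomeomorphUnitInterval (vert 1 0) = 0 := stdSimplexHomeomorphUnitInterval_zero
    change F (stdSimplexHomeomorphUnitInterval (vert 1 0), x) = g x
    rw [this, F.apply_zero]
  refine AddMonoidHom.ext fun a => ?_
  obtain ⟨c, rfl⟩ := QuotientAddGroup.mk_surjective a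
  have hc : coboundary n Y A c = 0 := c.2
  refine QuotientAddGroup.eq_iff_sub_mem.2 ?_
  -- Evaluate `bdry_prism` against the cocycle `c`: the boundary term is a value of `dc = 0`,
  -- leaving the two ends and the prism over the boundary.
  have key : ∀ σ : SingSimplex n X, cochainMap n A f c σ - cochainMap n A g c σ =
      prismPair H c σ (prism (vert 1 0) (vert 1 1) n (bdry n _ (tup (vert n)))) := by
    intro σ
    have h0 := prismPair_coboundary H (c : SingCochain n Y A) σ
      (prism (vert 1 0) (vert 1 1) (n + 1) (tup (vert n)))
    rw [hc, bdry_prism, map_sub, map_sub, prismPair_slice H _ σ _ hf,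
      prismPair_slice H _ σ _ hg] at h0
    have hz : prismPair H (0 : SingCochain (n + 1) Y A) σ = 0 :=
      tupleHom_ext fun v => prismPair_tup _ _ _ _
    rw [hz, LinearMap.zero_apply] at h0
    exact (sub_eq_zero.1 h0.symm)
  -- In degree `0` the remaining term is the prism on empty tuples, which is zero, so the two
  -- cochains agree; this is needed because `coboundaries 0` is trivial. In positive degree it is
  -- the coboundary of `prismDual`.
  cases n with
  | zero =>
    change cochainMap 0 A f c - cochainMap 0 A g c = 0
    funext σ
    exact (key σ).trans (by rw [prism, LinearMap.zero_apply, map_zero]; rfl)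
  | succ n =>
    refine ⟨prismDual H n c, funext fun σ => ?_⟩
    rw [← prismPair_prism_bdry, ← key]
    rfl

theorem cohMap_comp_apply {Z : Type*} [TopologicalSpace Z] (n : ℕ) (f : C(X, Y)) (g : C(Y, Z))
    (a : SingCohomology n Z A) : cohMap n A (g.comp f) a = cohMap n A f (cohMap n A g a) := by
  obtain ⟨c, rfl⟩ := QuotientAddGroup.mk_surjective a
  rfl

theorem cohMap_id_apply (n : ℕ) (a : SingCohomology n X A) :
    cohMap n A (ContinuousMap.id X) a = a := by
  obtain ⟨c, rfl⟩ := QuotientAddGroup.mk_surjective a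
  rfl

end Homotopy

/-! ### Exactness of the Mayer–Vietoris sequence at the target of the connecting homomorphism -/

section Exactness

variable {Y : Type u} [TopologicalSpace Y] {A : Type w} [AddCommGroup A]

theorem cohMap_succ_mk_eq_zero_iff {X : Type v} [TopologicalSpace X] {n : ℕ} (f : C(X, Y))
    (c : cocycles (n + 1) Y A) : cohMap (n + 1) A f (cohClass c) = 0 ↔
      ∃ b, coboundary n X A b = cochainMap (n + 1) A f c :=
  QuotientAddGroup.eq_zero_iff _

/-- The snake relation already contains primitives of `c` on `U` and on `V`, which gives one
direction. Conversely, any two such primitives differ on `U ∩ V` by a cocycle, whose class is a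
preimage. Small simplices enter only through the well-definedness of `coverConnecting`. -/
theorem mem_range_coverConnecting_iff {U V : Set Y} (hU : IsOpen U) (hV : IsOpen V)
    (hUV : U ∪ V = Set.univ) (n : ℕ) (b : SingCohomology (n + 1) Y A) :
    b ∈ (coverConnecting A hU hV hUV n).range ↔
      cohMap (n + 1) A (inclMap U) b = 0 ∧ cohMap (n + 1) A (inclMap V) b = 0 := by
  constructor
  · rintro ⟨a, ha⟩
    obtain ⟨z, b₁, b₂, c, -, rfl, -, h₁, h₂⟩ := (coverConnecting_eq_iff hU hV hUV n a b).1 ha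
    exact ⟨(cohMap_succ_mk_eq_zero_iff _ c).2 ⟨b₁, h₁.symm⟩,
      (cohMap_succ_mk_eq_zero_iff _ c).2 ⟨b₂, h₂.symm⟩⟩
  · obtain ⟨c, rfl⟩ := QuotientAddGroup.mk_surjective b
    rintro ⟨h₁, h₂⟩
    obtain ⟨b₁, h₁⟩ := (cohMap_succ_mk_eq_zero_iff _ c).1 h₁
    obtain ⟨b₂, h₂⟩ := (cohMap_succ_mk_eq_zero_iff _ c).1 h₂
    have hz : cochainMap n A (interLeft U V) b₁ - cochainMap n A (interRight U V) b₂ ∈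
        cocycles n ↥(U ∩ V) A := by
      change coboundary n _ A _ = 0
      rw [map_sub, coboundary_cochainMap, coboundary_cochainMap, h₁, h₂]
      -- Both terms are the restriction of `c` to `U ∩ V`, since the two composite inclusions into
      -- `Y` are definitionally equal.
      exact sub_self _
    exact ⟨cohClass ⟨_, hz⟩, (coverConnecting_eq_iff hU hV hUV n _ _).2
      ⟨⟨_, hz⟩, b₁, b₂, c, rfl, rfl, rfl, h₁.symm, h₂.symm⟩⟩

end Exactness

/-! ### The neighbourhoods of the two ends of a double mapping cylinder -/

namespace DMC

open scoped unitInterval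

variable {L B₁ B₂ Z : Type u} [TopologicalSpace L] [TopologicalSpace B₁] [TopologicalSpace B₂]
  [TopologicalSpace Z]

variable (f : C(L, B₁)) (g : C(L, B₂))

theorem cyl_mem_inter {l : L} {t : I} (h₀ : 0 < t) (h₁ : t < 1) :
    cyl f g (l, t) ∈ lower f g ∩ upper f g := ⟨h₁, h₀⟩

/-- `neck` and `height` are global coordinates on the open cylinder. Homotopies of the overlap can
therefore be written with continuous maps already at hand, without descending a map from a product
with a quotient. -/
theorem cyl_neck_height (y : ↥(lower f g ∩ upper f g)) :
    cyl f g (neck f g y, height f g y) = y := by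
  obtain ⟨y, h1, h0⟩ := y
  induction y using Quot.ind with | mk s => ?_
  rcases s with b | p | b
  · exact absurd (show (0 : I) < 0 from h0) (lt_irrefl _)
  · exact congrArg (fun l => cyl f g (l, p.2)) (neck_cyl f g p.1 p.2 ⟨h1, h0⟩)
  · exact absurd (show (1 : I) < 1 from h1) (lt_irrefl _)

/-- The point `1/2` of the unit interval. -/
def midpt : I := ⟨1 / 2, by norm_num, by norm_num⟩

theorem midpt_pos : 0 < midpt := Subtype.coe_lt_coe.1 (by norm_num [midpt])

theorem midpt_lt_one : midpt < 1 := Subtype.coe_lt_coe.1 (by norm_num [midpt])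

/-- The section `l ↦ (l, 1/2)` of `neck`. -/
def neckSection : C(L, ↥(lower f g ∩ upper f g)) where
  toFun l := ⟨cyl f g (l, midpt), cyl_mem_inter f g midpt_pos midpt_lt_one⟩
  continuous_toFun := by fun_prop

/-- The linear homotopy of the open cylinder onto its middle slice. -/
theorem neckSection_comp_neck_homotopic :
    (ContinuousMap.id _).Homotopic ((neckSection f g).comp (neck f g)) := by
  -- The height moves linearly to `1/2`. It stays strictly between `0` and `1`: at time `0` by
  -- membership in the overlap, and at positive times because of the positive weight on `1/2`.
  let T : I × ↥(lower f g ∩ upper f g) → I := fun p =>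
    ⟨(1 - (p.1 : ℝ)) * (height f g p.2 : ℝ) + p.1 * (1 / 2), by
      have h0 := p.1.2.1
      have h1 := p.1.2.2
      have h2 := (height f g p.2).2.1
      have h3 := (height f g p.2).2.2
      constructor <;> nlinarith⟩
  have hT : Continuous T := by fun_prop
  have hpos : ∀ p, 0 < T p := fun p => Subtype.coe_lt_coe.1 <| by
    change (0 : ℝ) < (1 - (p.1 : ℝ)) * (height f g p.2 : ℝ) + p.1 * (1 / 2)
    have h0 := p.1.2.1
    have h1 := p.1.2.2
    have h2 : (0 : ℝ) < height f g p.2 := p.2.2.2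
    rcases h0.eq_or_lt with h | h
    · rw [← h]; simpa using h2
    · nlinarith
  have hlt : ∀ p, T p < 1 := fun p => Subtype.coe_lt_coe.1 <| by
    change (1 - (p.1 : ℝ)) * (height f g p.2 : ℝ) + p.1 * (1 / 2) < (1 : ℝ)
    have h0 := p.1.2.1
    have h1 := p.1.2.2
    have h2 : (height f g p.2 : ℝ) < 1 := p.2.2.1
    rcases h0.eq_or_lt with h | h
    · rw [← h]; simpa using h2
    · nlinarith
  refine ⟨⟨⟨fun p => ⟨cyl f g (neck f g p.2, T p), cyl_mem_inter f g (hpos p) (hlt p)⟩,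
    by fun_prop⟩, fun y => ?_, fun y => ?_⟩⟩
  · refine Subtype.ext ?_
    have : T (0, y) = height f g y := Subtype.ext (by simp [T])
    change cyl f g (neck f g y, T (0, y)) = y
    rw [this, cyl_neck_height]
  · refine Subtype.ext ?_
    have : T (1, y) = midpt := Subtype.ext (by simp [T, midpt])
    change cyl f g (neck f g y, T (1, y)) = cyl f g (neck f g y, midpt)
    rw [this]

/-- Since `neckSection ∘ neck` is homotopic to the identity, `neckSection^*` provides preimages.
Surjectivity is the only part of the equivalence needed to compare the images of the connecting
maps. -/
theorem cohMap_neck_surjective (A : Type w) [AddCommGroup A] (n : ℕ) :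
    Function.Surjective (cohMap n A (neck f g)) := fun a =>
  ⟨cohMap n A (neckSection f g) a, by
    rw [← cohMap_comp_apply, ← cohMap_eq_of_homotopic n (neckSection_comp_neck_homotopic f g),
      cohMap_id_apply]⟩

theorem mem_range_connecting_iff {A : Type w} [AddCommGroup A] (n : ℕ)
    (b : SingCohomology (n + 1) (DMC f g) A) :
    b ∈ (connecting f g A n).range ↔ cohMap (n + 1) A (inclMap (lower f g)) b = 0 ∧
      cohMap (n + 1) A (inclMap (upper f g)) b = 0 := by
  rw [← mem_range_coverConnecting_iff (isOpen_lower f g) (isOpen_upper f g)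
    (lower_union_upper f g)]
  constructor
  · rintro ⟨a, rfl⟩
    exact ⟨_, rfl⟩
  · rintro ⟨a, rfl⟩
    obtain ⟨a, rfl⟩ := cohMap_neck_surjective f g A n a
    exact ⟨a, rfl⟩

/-! ### Retractions of the two neighbourhoods onto the ends -/

open Classical in
/-- The retraction of `lower` to `B₁`, undefined elsewhere. -/
def lowerOption : DMC f g → Option B₁ :=
  Quot.lift (Sum.elim some
    (Sum.elim (fun p => if p.2 < 1 then some (f p.1) else none) fun _ => none)) (by
    rintro _ _ (l | l) <;> simp)

open Classical in
/-- The retraction of `upper` to `B₂`, undefined elsewhere. -/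
def upperOption : DMC f g → Option B₂ :=
  Quot.lift (Sum.elim (fun _ => none)
    (Sum.elim (fun p => if 0 < p.2 then some (g p.1) else none) some)) (by
    rintro _ _ (l | l) <;> simp)

theorem lowerOption_isSome (y : lower f g) : (lowerOption f g y).isSome := by
  obtain ⟨y, h⟩ := y
  induction y using Quot.ind with | mk s => ?_
  rcases s with b | p | b
  · rfl
  · change (if p.2 < 1 then some (f p.1) else none).isSome
    rw [if_pos (show p.2 < 1 from h)]
    rfl
  · exact absurd (show (1 : I) < 1 from h) (lt_irrefl _)

theorem upperOption_isSome (y : upper f g) : (upperOption f g y).isSome := by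
  obtain ⟨y, h⟩ := y
  induction y using Quot.ind with | mk s => ?_
  rcases s with b | p | b
  · exact absurd (show (0 : I) < 0 from h) (lt_irrefl _)
  · change (if 0 < p.2 then some (g p.1) else none).isSome
    rw [if_pos (show 0 < p.2 from h)]
    rfl
  · rfl

/-- Openness is tested on the three pieces before gluing, where the preimages are `O`, the part of
`f⁻¹ O × I` with second coordinate less than `1`, and the empty set. Extending the retraction by
`none` makes it a function on the whole quotient, so the quotient topology applies directly and
gives continuity of `lowerRetr`. -/
theorem isOpen_lowerOption {O : Set B₁} (hO : IsOpen O) :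
    IsOpen {y : DMC f g | ∃ b ∈ O, lowerOption f g y = some b} := by
  change IsOpen (Quot.mk (DMCRel f g) ⁻¹' {y : DMC f g | ∃ b ∈ O, lowerOption f g y = some b})
  refine isOpen_sum_iff.2 ⟨?_, isOpen_sum_iff.2 ⟨?_, ?_⟩⟩
  · convert hO using 1
    ext b
    change (∃ b' ∈ O, some b = some b') ↔ b ∈ O
    simp
  · convert (hO.preimage (f.continuous.comp (continuous_fst (X := L) (Y := I)))).inter
      (isOpen_lt (continuous_snd (X := L) (Y := I)) continuous_const :
        IsOpen {p : L × I | p.2 < 1}) using 1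
    ext p
    change (∃ b ∈ O, (if p.2 < 1 then some (f p.1) else none) = some b) ↔ f p.1 ∈ O ∧ p.2 < 1
    split_ifs with h
    · simp [h]
    · simp [h]
  · convert isOpen_empty
    refine Set.eq_empty_of_forall_notMem ?_
    rintro b ⟨l, -, hl⟩
    exact Option.some_ne_none l hl.symm

theorem isOpen_upperOption {O : Set B₂} (hO : IsOpen O) :
    IsOpen {y : DMC f g | ∃ b ∈ O, upperOption f g y = some b} := by
  change IsOpen (Quot.mk (DMCRel f g) ⁻¹' {y : DMC f g | ∃ b ∈ O, upperOption f g y = some b})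
  refine isOpen_sum_iff.2 ⟨?_, isOpen_sum_iff.2 ⟨?_, ?_⟩⟩
  · convert isOpen_empty
    refine Set.eq_empty_of_forall_notMem ?_
    rintro b ⟨l, -, hl⟩
    exact Option.some_ne_none l hl.symm
  · convert (hO.preimage (g.continuous.comp (continuous_fst (X := L) (Y := I)))).inter
      (isOpen_lt continuous_const (continuous_snd (X := L) (Y := I)) :
        IsOpen {p : L × I | 0 < p.2}) using 1
    ext p
    change (∃ b ∈ O, (if 0 < p.2 then some (g p.1) else none) = some b) ↔ g p.1 ∈ O ∧ 0 < p.2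
    split_ifs with h
    · simp [h]
    · simp [h]
  · convert hO using 1
    ext b
    change (∃ b' ∈ O, some b = some b') ↔ b ∈ O
    simp

/-- The retraction of `lower` to `B₁`. -/
def lowerRetr : C(lower f g, B₁) where
  toFun y := (lowerOption f g y).get (lowerOption_isSome f g y)
  continuous_toFun := by
    refine continuous_def.2 fun O hO => ?_
    convert (isOpen_lowerOption f g hO).preimage continuous_subtype_val using 1
    ext y
    constructor
    · intro h
      exact ⟨_, h, (Option.some_get _).symm⟩
    · rintro ⟨b, hb, h⟩
      change (lowerOption f g y).get (lowerOption_isSome f g y) ∈ O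
      simpa [h] using hb

/-- The retraction of `upper` to `B₂`. -/
def upperRetr : C(upper f g, B₂) where
  toFun y := (upperOption f g y).get (upperOption_isSome f g y)
  continuous_toFun := by
    refine continuous_def.2 fun O hO => ?_
    convert (isOpen_upperOption f g hO).preimage continuous_subtype_val using 1
    ext y
    constructor
    · intro h
      exact ⟨_, h, (Option.some_get _).symm⟩
    · rintro ⟨b, hb, h⟩
      change (upperOption f g y).get (upperOption_isSome f g y) ∈ O
      simpa [h] using hb

variable {f g}

/-- On the cylinder both sides are `p₁ (f l)`, whatever the height. This strict equality replaces
any use of a deformation retraction of `lower` onto `B₁`. -/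
theorem whisker_comp_lower (p₁ : C(B₁, Z)) (p₂ : C(B₂, Z)) (h : ∀ l, p₁ (f l) = p₂ (g l)) :
    (whisker p₁ p₂ h).comp (inclMap (lower f g)) = p₁.comp (lowerRetr f g) := by
  ext ⟨y, hy⟩
  induction y using Quot.ind with | mk s => ?_
  rcases s with b | p | b
  · rfl
  · have : lowerRetr f g ⟨_, hy⟩ = f p.1 := Option.get_of_eq_some _ (if_pos hy)
    exact (congrArg p₁ this).symm
  · exact absurd (show (1 : I) < 1 from hy) (lt_irrefl _)

theorem whisker_comp_upper (p₁ : C(B₁, Z)) (p₂ : C(B₂, Z)) (h : ∀ l, p₁ (f l) = p₂ (g l)) :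
    (whisker p₁ p₂ h).comp (inclMap (upper f g)) = p₂.comp (upperRetr f g) := by
  ext ⟨y, hy⟩
  induction y using Quot.ind with | mk s => ?_
  rcases s with b | p | b
  · exact absurd (show (0 : I) < 0 from hy) (lt_irrefl _)
  · have : upperRetr f g ⟨_, hy⟩ = g p.1 := Option.get_of_eq_some _ (if_pos hy)
    -- `whisker` is defined on the cylinder through `p₁ ∘ f`, so the compatibility `h` is needed on
    -- this side.
    exact (h p.1).trans (congrArg p₂ this).symm
  · rfl

variable (f g) in
/-- The inclusion of `B₁` into its neighbourhood `lower`. -/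
def lowerIncl : C(B₁, lower f g) :=
  ⟨fun b => ⟨i₁ f g b, show (0 : I) < 1 from zero_lt_one⟩, by fun_prop⟩

end DMC

/-! ### Zero-divisors and the path fibration -/

section ZeroDivisor

open scoped unitInterval

variable (X : Type u) [TopologicalSpace X]

/-- The constant paths. -/
def constPath : C(X, PathSp X) := ContinuousMap.const'

theorem endpoints_comp_constPath : (endpoints X).comp (constPath X) = diag X := rfl

/-- The starting point of a path. -/
def startPt : C(PathSp X, X) := ⟨fun γ => γ 0, continuous_eval_const (0 : I)⟩

/-- Contracting paths to their starting points deforms the end point map into the diagonal. -/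
theorem diag_comp_startPt_homotopic :
    ((diag X).comp (startPt X)).Homotopic (endpoints X) :=
  -- At time `s` a path is sent to `(γ 0, γ s)`. This is jointly continuous because evaluation is,
  -- the interval being locally compact.
  ⟨⟨⟨fun p => (p.2 0, p.2 p.1), by fun_prop⟩, fun _ => rfl, fun _ => rfl⟩⟩

variable {X}

/-- Each of `diag X` and `endpoints X` factors through the other: the former strictly via constant
paths, the latter up to homotopy via starting points. Their pullbacks therefore have the same
kernel. -/
theorem isZeroDivisor_iff_endpoints {A : Type w} [AddCommGroup A] {n : ℕ}
    (u : SingCohomology n (X × X) A) : IsZeroDivisor u ↔ cohMap n A (endpoints X) u = 0 := by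
  rw [IsZeroDivisor, AddMonoidHom.mem_ker]
  constructor
  · intro h
    rw [← cohMap_eq_of_homotopic n (diag_comp_startPt_homotopic X), cohMap_comp_apply, h, map_zero]
  · intro h
    rw [← endpoints_comp_constPath, cohMap_comp_apply, h, map_zero]

end ZeroDivisor

end MVJoin

end

/-! ### Zero-divisors and the image of the connecting homomorphism; the positive degree is written
`k + 1` -/

theorem proposition2p4 {X : Type*} [TopologicalSpace X] {A : Type*} [AddCommGroup A]
    (k : ℕ) (u : MVJoin.SingCohomology (k + 1) (X × X) A) :
    MVJoin.IsZeroDivisor u ↔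
      MVJoin.cohMap (k + 1) A (MVJoin.p₂ X) u ∈
        (MVJoin.DMC.connecting (MVJoin.r₁ X) (MVJoin.r₂ X) A k).range := by
  rw [MVJoin.isZeroDivisor_iff_endpoints, MVJoin.DMC.mem_range_connecting_iff,
    ← MVJoin.cohMap_comp_apply, ← MVJoin.cohMap_comp_apply]
  constructor
  · intro h
    -- Both restrictions of `p₂` factor through `endpoints X`, which kills `u`.
    rw [MVJoin.p₂, MVJoin.DMC.whisker_comp_lower, MVJoin.DMC.whisker_comp_upper,
      MVJoin.cohMap_comp_apply, MVJoin.cohMap_comp_apply, h, map_zero, map_zero]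
    exact ⟨rfl, rfl⟩
  -- One end suffices: `p₂ ∘ i₁ = endpoints X`, and `i₁` factors through `lower`, where the pullback
  -- of `u` vanishes.
  · rintro ⟨h, -⟩
    rw [← MVJoin.p₂_comp_i₁]
    change MVJoin.cohMap (k + 1) A (((MVJoin.p₂ X).comp (MVJoin.inclMap _)).comp
      (MVJoin.DMC.lowerIncl _ _)) u = 0
    rw [MVJoin.cohMap_comp_apply, h, map_zero]
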